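/- Let $d$ be a natural number, $\mathbb T^d=(\mathbb R/2\pi\mathbb Z)^d$, and let $V=V(p,q)\in C^\infty(\mathbb R^d\times\mathbb T^d)$ be a real function that is globally bounded together with all its derivatives, i.e. $\sup_{p\in\mathbb R^d,\,q\in\mathbb T^d}|\partial_p^\alpha\partial_q^\beta V(p,q)|<\infty$ for all multi-indices $\alpha,\beta\in\mathbb N^d$. For $\varepsilon>0$ consider the Hamiltonian $$H(p,q)=\sum_{j=1}^d\frac{p_j^2}{2}+\varepsilon V(p,q),\qquad (p,q)\in\mathbb R^d\times\mathbb T^d ,$$ with Hamilton's equations $\dot p_j=-\partial H/\partial q_j$, $\dot q_j=\partial H/\partial p_j$. Fix $b$ with $0<b<\tfrac12$. Then for every real $M>0$ there exist constants $C_M>0$ and $\varepsilon_M>0$ such that, whenever $0<\varepsilon<\varepsilon_M$, for every initial datum $(p_0,q_0)\in\mathbb R^d\times\mathbb T^d$ Hamilton's equations have a solution $(p(t),q(t))$ defined for all $t\in\mathbb R$ with $(p(0),q(0))=(p_0,q_0)$, and every such solution satisfies $$|p(t)-p(0)|\le C_M\,\varepsilon^{b}\qquad\text{for all } t\in\mathbb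 R \text{ with } |t|\le \frac{C_M}{\varepsilon^{M}} ,$$ where $|\cdot|$ is the Euclidean norm. -/

import Mathlib

open scoped ContDiff

noncomputable section

namespace SmoothNekhoroshev

/-- Momentum space `ℝ^d`, with the Euclidean norm. -/
abbrev Momentum (d : ℕ) : Type := EuclideanSpace ℝ (Fin d)

/-- The torus `𝕋^d = (ℝ / 2πℤ)^d`. -/
abbrev Torus (d : ℕ) : Type := Fin d → AddCircle (2 * Real.pi)

/-- The covering map `ℝ^d → 𝕋^d`. -/
def toTorus {d : ℕ} (x : EuclideanSpace ℝ (Fin d)) : Torus d :=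
  fun j => ((x j : ℝ) : AddCircle (2 * Real.pi))

/-- The lift of a function on `ℝ^d × 𝕋^d` to a function on `ℝ^d × ℝ^d`, periodic in the second
variable. -/
def lift {d : ℕ} (F : Momentum d → Torus d → ℝ) :
    Momentum d × EuclideanSpace ℝ (Fin d) → ℝ :=
  fun z => F z.1 (toTorus z.2)

/-- `F` is of class `C^∞` on `ℝ^d × 𝕋^d`. -/
def IsSmooth {d : ℕ} (F : Momentum d → Torus d → ℝ) : Prop :=
  ContDiff ℝ ∞ (lift F)

/-- `F` is bounded on `ℝ^d × 𝕋^d` together with each of its derivatives: for every order `n` the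
derivatives of order `n` are bounded (`n = 0` being the boundedness of `F` itself). -/
def IsGloballyBounded {d : ℕ} (F : Momentum d → Torus d → ℝ) : Prop :=
  ∀ n : ℕ, ∃ K : ℝ, ∀ z : Momentum d × EuclideanSpace ℝ (Fin d),
    ‖iteratedFDeriv ℝ n (lift F) z‖ ≤ K

/-- The Hamiltonian `H(p, q) = ∑ p_j² / 2 + ε V(p, q)`. -/
def hamiltonian {d : ℕ} (V : Momentum d → Torus d → ℝ) (ε : ℝ) :
    Momentum d → Torus d → ℝ :=
  fun p q => (∑ j, p j ^ 2 / 2) + ε * V p q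

/-- The partial derivative `∂F/∂p_j`, at a point of the covering space. -/
def partialP {d : ℕ} (F : Momentum d → Torus d → ℝ) (j : Fin d)
    (z : Momentum d × EuclideanSpace ℝ (Fin d)) : ℝ :=
  fderiv ℝ (lift F) z (EuclideanSpace.single j 1, 0)

/-- The partial derivative `∂F/∂q_j`, at a point of the covering space. -/
def partialQ {d : ℕ} (F : Momentum d → Torus d → ℝ) (j : Fin d)
    (z : Momentum d × EuclideanSpace ℝ (Fin d)) : ℝ :=
  fderiv ℝ (lift F) z (0, EuclideanSpace.single j 1)

/-- The curve `t ↦ (p t, q t)` in `ℝ^d × 𝕋^d`, defined for all times, solves Hamilton's equations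
`ṗ_j = -∂H/∂q_j`, `q̇_j = ∂H/∂p_j`. The equations are written on a lift `x` of `q` to `ℝ^d`. -/
def IsSolution {d : ℕ} (H : Momentum d → Torus d → ℝ)
    (p : ℝ → Momentum d) (q : ℝ → Torus d) : Prop :=
  ∃ x : ℝ → EuclideanSpace ℝ (Fin d), (∀ t, toTorus (x t) = q t) ∧
    ∀ (t : ℝ) (j : Fin d),
      HasDerivAt (fun s => p s j) (-partialQ H j (p t, x t)) t ∧
      HasDerivAt (fun s => x s j) (partialP H j (p t, x t)) t

end SmoothNekhoroshev

end

/-!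
Write `ε = η ρ²` and rescale the momenta around a centre `w` by `p = w + ρ P`. Up to factors the
Hamiltonian becomes `v · P + X⁻¹ (|P|² / 2 + η V)` with `v = w / (X ρ)`, where `X` is a small
negative power of `ε`. Every initial momentum lies within `ρ / 8` of some `w` such that each
divisor `k · v` with `|k| ≤ X` is either zero or at least `1` in absolute value, for some `ρ`
between `X √ε` and `X ^ (B + 1) √ε`: as long as this fails, a new resonance is found to project
on, which is possible at most `d` times.

The linear Hamiltonian `v · P` can be continued to a formal integral of the motion in powers of
`X⁻¹`. Each step is a homological equation `{v · P, χ} = f - average of f`: the frequencies up to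
`X` are harmless by the choice of `w`, and the others are smaller than any power of `X⁻¹` because
`f` is smooth. Truncating the series gives a function within `O(X⁻²)` of `v · P` that is almost
constant up to times `X ^ N`. Conservation of energy and the convexity of `|P|² / 2` then keep `P`
bounded, so `p` moves by at most `ρ ≤ ε ^ b`.
-/

noncomputable section

namespace SmoothNekhoroshev

open Finset.HasAntidiagonal (antidiagonal mem_antidiagonal)

section Antidiagonal

variable {A : Type*} [AddCommMonoid A] (f : ℕ → ℕ → ℕ → A) (n : ℕ)

theorem sum_antidiagonal_assoc :
    ∑ x ∈ antidiagonal n, ∑ y ∈ antidiagonal x.1, f y.1 y.2 x.2 =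
      ∑ x ∈ antidiagonal n, ∑ y ∈ antidiagonal x.2, f x.1 y.1 y.2 := by
  simp only [Finset.sum_sigma']
  refine Finset.sum_nbij' (fun ⟨⟨_, c⟩, a, b⟩ => ⟨(a, b + c), (b, c)⟩)
    (fun ⟨⟨a, _⟩, b, c⟩ => ⟨(a + b, c), (a, b)⟩) ?_ ?_ ?_ ?_ ?_ <;>
    rintro ⟨⟨_, _⟩, _, _⟩ h <;> simp only [Finset.mem_sigma, mem_antidiagonal] at h ⊢ <;> grind

theorem sum_antidiagonal_right_comm :
    ∑ x ∈ antidiagonal n, ∑ y ∈ antidiagonal x.1, f y.1 y.2 x.2 =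
      ∑ x ∈ antidiagonal n, ∑ y ∈ antidiagonal x.1, f y.1 x.2 y.2 := by
  rw [sum_antidiagonal_assoc f, sum_antidiagonal_assoc fun a b c => f a c b]
  exact Finset.sum_congr rfl fun x _ =>
    (Finset.Nat.sum_antidiagonal_swap (f := fun y => f x.1 y.1 y.2)).symm

end Antidiagonal

section LieTransform

variable {K 𝔤 : Type*} [Field K] [AddCommGroup 𝔤] [Module K 𝔤] (br : 𝔤 →ₗ[K] 𝔤 →ₗ[K] 𝔤)

/-- The bracket of the formal power series `∑ F n s ^ n` and `∑ G n s ^ n`. -/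
def seriesBracket (F G : ℕ → 𝔤) (n : ℕ) : 𝔤 :=
  ∑ x ∈ antidiagonal n, br (F x.1) (G x.2)

/-- The derivative of the formal power series `∑ F n s ^ n`. -/
def seriesDeriv (F : ℕ → 𝔤) (n : ℕ) : 𝔤 :=
  ((n : K) + 1) • F (n + 1)

/-- The Lie transform (in Deprit's form) of `f` generated by the series `W`: the formal power
series solution `F` of the differential equation `F' = [F, W]`, `F(0) = f`. -/
def lieTransform (W : ℕ → 𝔤) (f : 𝔤) : ℕ → 𝔤
  | 0 => f
  | n + 1 => ((n : K) + 1)⁻¹ • ∑ i : Fin (n + 1), br (lieTransform W f (n - i)) (W i)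

/-- The Lie transform of a series `Z`, extending the transform of its coefficients by linearity. -/
def seriesTransform (W Z : ℕ → 𝔤) (n : ℕ) : 𝔤 :=
  ∑ x ∈ antidiagonal n, lieTransform br W (Z x.1) x.2

variable {br}

@[simp] theorem lieTransform_zero (W : ℕ → 𝔤) (f : 𝔤) : lieTransform br W f 0 = f := by
  rw [lieTransform]

theorem lieTransform_succ (W : ℕ → 𝔤) (f : 𝔤) (n : ℕ) :
    lieTransform br W f (n + 1) = ((n : K) + 1)⁻¹ • seriesBracket br (lieTransform br W f) W n := by
  rw [lieTransform, Fin.sum_univ_eq_sum_range (fun i => br (lieTransform br W f (n - i)) (W i)),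
    ← Finset.Nat.sum_antidiagonal_eq_sum_range_succ (fun i j => br (lieTransform br W f j) (W i)),
    ← Finset.Nat.sum_antidiagonal_swap]
  rfl

theorem lieTransform_one (W : ℕ → 𝔤) (f : 𝔤) : lieTransform br W f 1 = br f (W 0) := by
  simp [lieTransform_succ, seriesBracket]

theorem lieTransform_congr {W W' : ℕ → 𝔤} (f : 𝔤) {n : ℕ} (h : ∀ i < n, W i = W' i) :
    lieTransform br W f n = lieTransform br W' f n := by
  induction n using Nat.strong_induction_on with
  | _ n ih =>
    cases n with
    | zero => simp
    | succ n =>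
      rw [lieTransform_succ, lieTransform_succ]
      congr 1
      refine Finset.sum_congr rfl fun x hx => ?_
      have hx' := mem_antidiagonal.1 hx
      rw [h x.2 (by omega), ih x.1 (by omega) fun i hi => h i (by omega)]

section Submodule

variable {U S : Submodule K 𝔤} {W : ℕ → 𝔤}

theorem lieTransform_mem (hS : ∀ f ∈ S, ∀ g ∈ U, br f g ∈ S) (hW : ∀ n, W n ∈ U) {f : 𝔤}
    (hf : f ∈ S) (n : ℕ) : lieTransform br W f n ∈ S := by
  induction n using Nat.strong_induction_on with
  | _ n ih =>
    cases n with
    | zero => simpa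
    | succ n =>
      rw [lieTransform_succ]
      refine S.smul_mem _ (S.sum_mem fun x hx => hS _ (ih _ ?_) _ (hW _))
      have := mem_antidiagonal.1 hx
      omega

theorem lieTransform_succ_mem (hU : ∀ f ∈ U, ∀ g ∈ U, br f g ∈ U) (hW : ∀ n, W n ∈ U) {h : 𝔤}
    (hh : ∀ n, br h (W n) ∈ U) (n : ℕ) : lieTransform br W h (n + 1) ∈ U := by
  induction n using Nat.strong_induction_on with
  | _ n ih =>
    rw [lieTransform_succ]
    refine U.smul_mem _ (U.sum_mem fun x hx => ?_)
    rcases x with ⟨_ | a, b⟩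
    · rw [lieTransform_zero]
      exact hh b
    · have := mem_antidiagonal.1 hx
      exact hU _ (ih a (by simp only at this; omega)) _ (hW _)

theorem seriesTransform_succ_mem (hU : ∀ f ∈ U, ∀ g ∈ U, br f g ∈ U) (hW : ∀ n, W n ∈ U)
    {Z : ℕ → 𝔤} (hZW : ∀ n, br (Z 0) (W n) ∈ U) (hZ : ∀ n, Z (n + 1) ∈ U) (n : ℕ) :
    seriesTransform br W Z (n + 1) ∈ U := by
  refine U.sum_mem fun x hx => ?_
  rcases x with ⟨_ | a, b⟩
  · obtain rfl : b = n + 1 := by simpa using mem_antidiagonal.1 hx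
    exact lieTransform_succ_mem hU hW hZW n
  · exact lieTransform_mem hU hW (hZ a) b

end Submodule

section Update

theorem lieTransform_update_succ (W : ℕ → 𝔤) (f w : 𝔤) (n : ℕ) :
    lieTransform br (Function.update W n (W n + w)) f (n + 1) =
      lieTransform br W f (n + 1) + ((n : K) + 1)⁻¹ • br f w := by
  have hcongr : ∀ {k}, k ≤ n → lieTransform br (Function.update W n (W n + w)) f k =
      lieTransform br W f k := fun hk =>
    lieTransform_congr f fun i hi => Function.update_of_ne (by omega) _ _
  rw [lieTransform_succ, lieTransform_succ, ← smul_add]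
  congr 1
  rcases n with _ | n
  · simp [seriesBracket]
  · simp only [seriesBracket, Finset.Nat.sum_antidiagonal_succ, lieTransform_zero,
      Function.update_self, map_add]
    rw [add_right_comm]
    congr 1
    congr 1
    refine Finset.sum_congr rfl fun x hx => ?_
    have hx' := mem_antidiagonal.1 hx
    rw [hcongr (by omega), Function.update_of_ne (by omega)]

theorem seriesTransform_congr {W W' Z Z' : ℕ → 𝔤} {n : ℕ} (hW : ∀ i < n, W i = W' i)
    (hZ : ∀ i ≤ n, Z i = Z' i) : seriesTransform br W Z n = seriesTransform br W' Z' n := by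
  refine Finset.sum_congr rfl fun x hx => ?_
  have hx' := mem_antidiagonal.1 hx
  rw [hZ x.1 (by omega)]
  exact lieTransform_congr _ fun i hi => hW i (by omega)

theorem seriesTransform_update_succ (W Z : ℕ → 𝔤) (w z : 𝔤) (n : ℕ) :
    seriesTransform br (Function.update W n (W n + w))
        (Function.update Z (n + 1) (Z (n + 1) + z)) (n + 1) =
      seriesTransform br W Z (n + 1) + (((n : K) + 1)⁻¹ • br (Z 0) w + z) := by
  have hterm : ∀ x ∈ antidiagonal (n + 1), lieTransform br (Function.update W n (W n + w))
      (Function.update Z (n + 1) (Z (n + 1) + z) x.1) x.2 = lieTransform br W (Z x.1) x.2 +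
        ((if x = (0, n + 1) then ((n : K) + 1)⁻¹ • br (Z 0) w else 0) +
          if x = (n + 1, 0) then z else 0) := by
    rintro ⟨_ | a, b⟩ hx
    · obtain rfl : b = n + 1 := by simpa using mem_antidiagonal.1 hx
      simp [lieTransform_update_succ]
    · obtain rfl : a + b = n := by have := mem_antidiagonal.1 hx; simp only at this; omega
      rcases b with _ | b
      · simp
      · rw [Function.update_of_ne (by simp), if_neg (by simp), if_neg (by simp), add_zero, add_zero]
        exact lieTransform_congr _ fun i hi => Function.update_of_ne (by omega) _ _
  rw [seriesTransform, Finset.sum_congr rfl hterm, Finset.sum_add_distrib, Finset.sum_add_distrib,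
    Finset.sum_ite_eq', Finset.sum_ite_eq', if_pos (by simp), if_pos (by simp), seriesTransform]

end Update

section Morphism

theorem seriesDeriv_seriesBracket (F G : ℕ → 𝔤) :
    seriesDeriv (K := K) (seriesBracket br F G) =
      seriesBracket br (seriesDeriv (K := K) F) G +
        seriesBracket br F (seriesDeriv (K := K) G) := by
  ext n
  have hleft : ∑ x ∈ antidiagonal (n + 1), br ((x.1 : K) • F x.1) (G x.2) =
      seriesBracket br (seriesDeriv (K := K) F) G n := by
    simp [Finset.Nat.sum_antidiagonal_succ, seriesBracket, seriesDeriv]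
  have hright : ∑ x ∈ antidiagonal (n + 1), br (F x.1) ((x.2 : K) • G x.2) =
      seriesBracket br F (seriesDeriv (K := K) G) n := by
    simp [Finset.Nat.sum_antidiagonal_succ', seriesBracket, seriesDeriv]
  rw [Pi.add_apply, ← hleft, ← hright, ← Finset.sum_add_distrib, seriesDeriv, seriesBracket,
    Finset.smul_sum]
  refine Finset.sum_congr rfl fun x hx => ?_
  have hx' : (n : K) + 1 = x.1 + x.2 := by
    rw [← Nat.cast_add, mem_antidiagonal.1 hx, Nat.cast_succ]
  rw [hx', add_smul, map_smul, LinearMap.smul_apply, map_smul]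

theorem seriesBracket_leibniz
    (leib : ∀ f g w, br (br f w) g + br f (br g w) = br (br f g) w) (F G W : ℕ → 𝔤) :
    seriesBracket br (seriesBracket br F W) G + seriesBracket br F (seriesBracket br G W) =
      seriesBracket br (seriesBracket br F G) W := by
  ext n
  simp only [Pi.add_apply, seriesBracket, map_sum, LinearMap.sum_apply]
  rw [sum_antidiagonal_right_comm fun a b c => br (br (F a) (W b)) (G c),
    ← sum_antidiagonal_assoc fun a b c => br (F a) (br (G b) (W c)), ← Finset.sum_add_distrib]
  refine Finset.sum_congr rfl fun x _ => ?_
  rw [← Finset.sum_add_distrib]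
  exact Finset.sum_congr rfl fun y _ => leib _ _ _

variable [CharZero K]

theorem seriesDeriv_lieTransform (W : ℕ → 𝔤) (f : 𝔤) :
    seriesDeriv (K := K) (lieTransform br W f) = seriesBracket br (lieTransform br W f) W := by
  ext n
  rw [seriesDeriv, lieTransform_succ, smul_inv_smul₀ (by exact_mod_cast n.succ_ne_zero)]

theorem eq_lieTransform {W F : ℕ → 𝔤}
    (hF : seriesDeriv (K := K) F = seriesBracket br F W) : F = lieTransform br W (F 0) := by
  ext n
  induction n using Nat.strong_induction_on with
  | _ n ih =>
    cases n with
    | zero => simp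
    | succ n =>
      have hn : ((n : K) + 1) ≠ 0 := by exact_mod_cast n.succ_ne_zero
      rw [lieTransform_succ, eq_inv_smul_iff₀ hn, ← seriesDeriv, hF]
      refine Finset.sum_congr rfl fun x hx => ?_
      have := mem_antidiagonal.1 hx
      rw [ih x.1 (by omega)]

variable (leib : ∀ f g w, br (br f w) g + br f (br g w) = br (br f g) w)
include leib

theorem seriesBracket_lieTransform (W : ℕ → 𝔤) (f g : 𝔤) :
    seriesBracket br (lieTransform br W f) (lieTransform br W g) =
      lieTransform br W (br f g) := by
  have hode := seriesBracket_leibniz leib (lieTransform br W f) (lieTransform br W g) W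
  rw [← seriesDeriv_lieTransform, ← seriesDeriv_lieTransform, ← seriesDeriv_seriesBracket] at hode
  simpa [seriesBracket] using eq_lieTransform hode

theorem seriesBracket_seriesTransform (W Z : ℕ → 𝔤) (f : 𝔤) :
    seriesBracket br (lieTransform br W f) (seriesTransform br W Z) =
      seriesTransform br W fun n => br f (Z n) := by
  ext n
  simp only [seriesBracket, seriesTransform, map_sum]
  rw [← sum_antidiagonal_assoc fun a b c => br (lieTransform br W f a) (lieTransform br W (Z b) c)]
  simp only [← seriesBracket_lieTransform leib, seriesBracket]
  rw [← sum_antidiagonal_assoc fun b a c =>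
    br (lieTransform br W f a) (lieTransform br W (Z b) c)]
  exact Finset.sum_congr rfl fun x _ =>
    (Finset.Nat.sum_antidiagonal_swap (f := fun y =>
      br (lieTransform br W f y.2) (lieTransform br W (Z y.1) x.2)))

end Morphism

/-- Generators `W` and coefficients `Z` of a formal normal form around `h`: `Z` starts with `h`, and
commutes with `h` up to elements of `m`; all other terms lie in `U`. -/
structure IsNormalFormPair (br : 𝔤 →ₗ[K] 𝔤 →ₗ[K] 𝔤) (U m : Submodule K 𝔤) (h : 𝔤)
    (W Z : ℕ → 𝔤) : Prop where
  gen_mem (n : ℕ) : W n ∈ U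
  br_gen_mem (n : ℕ) : br h (W n) ∈ U
  zero : Z 0 = h
  succ_mem (n : ℕ) : Z (n + 1) ∈ U
  br_succ_mem (n : ℕ) : br h (Z (n + 1)) ∈ m

section NormalForm

variable {U m : Submodule K 𝔤} {h : 𝔤} {W Z : ℕ → 𝔤}

theorem IsNormalFormPair.update (hWZ : IsNormalFormPair br U m h W Z) {w z : 𝔤} (n : ℕ)
    (hw : w ∈ U) (hhw : br h w ∈ U) (hz : z ∈ U) (hhz : br h z ∈ m) :
    IsNormalFormPair br U m h (Function.update W n (W n + w))
      (Function.update Z (n + 1) (Z (n + 1) + z)) where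
  gen_mem := Function.forall_update_iff W (fun _ x => x ∈ U) |>.2
    ⟨U.add_mem (hWZ.gen_mem n) hw, fun k _ => hWZ.gen_mem k⟩
  br_gen_mem := Function.forall_update_iff W (fun _ x => br h x ∈ U) |>.2
    ⟨by rw [map_add]; exact U.add_mem (hWZ.br_gen_mem n) hhw, fun k _ => hWZ.br_gen_mem k⟩
  zero := by rw [Function.update_of_ne (by simp), hWZ.zero]
  succ_mem k := by
    rcases eq_or_ne k n with rfl | hk
    · simpa using U.add_mem (hWZ.succ_mem k) hz
    · simpa [Function.update_of_ne, hk] using hWZ.succ_mem k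
  br_succ_mem k := by
    rcases eq_or_ne k n with rfl | hk
    · simpa using m.add_mem (hWZ.br_succ_mem k) hhz
    · simpa [Function.update_of_ne, hk] using hWZ.br_succ_mem k

variable [CharZero K] (hU : ∀ f ∈ U, ∀ g ∈ U, br f g ∈ U)
  (solve : ∀ f ∈ U, ∃ χ ∈ U, ∃ z ∈ U, f = br h χ + z ∧ br h z ∈ m)
include hU solve

theorem IsNormalFormPair.exists_extend (hWZ : IsNormalFormPair br U m h W Z) {n : ℕ} {f : 𝔤}
    (hf : f ∈ U) : ∃ W' Z', IsNormalFormPair br U m h W' Z' ∧ (∀ i < n, W' i = W i) ∧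
      (∀ i ≤ n, Z' i = Z i) ∧ seriesTransform br W' Z' (n + 1) = f := by
  have hr : f - seriesTransform br W Z (n + 1) ∈ U := U.sub_mem hf <|
    seriesTransform_succ_mem hU hWZ.gen_mem (by rw [hWZ.zero]; exact hWZ.br_gen_mem)
      hWZ.succ_mem n
  obtain ⟨χ, hχ, z, hz, hsol, hzm⟩ := solve _ hr
  have hn : (n : K) + 1 ≠ 0 := by exact_mod_cast n.succ_ne_zero
  have hhχ : br h χ ∈ U := by rw [eq_sub_of_add_eq hsol.symm]; exact U.sub_mem hr hz
  refine ⟨_, _, hWZ.update n (w := ((n : K) + 1) • χ) (U.smul_mem _ hχ)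
    (by rw [map_smul]; exact U.smul_mem _ hhχ) hz hzm,
    fun i hi => Function.update_of_ne (by omega) _ _,
    fun i hi => Function.update_of_ne (by omega) _ _, ?_⟩
  rw [seriesTransform_update_succ, hWZ.zero, map_smul, inv_smul_smul₀ hn, ← hsol, add_sub_cancel]

/-- Birkhoff normal form: the first step may be prescribed, and the homological equation `solve`
gives the following ones. -/
theorem exists_normalForm {H : ℕ → 𝔤} (hH0 : H 0 = h) (hH : ∀ n, H (n + 1) ∈ U) {w z : 𝔤}
    (hw : w ∈ U) (hz : z ∈ U) (hsol : H 1 = br h w + z) (hzm : br h z ∈ m) (N : ℕ) :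
    ∃ W Z, IsNormalFormPair br U m h W Z ∧ W 0 = w ∧
      ∀ n ≤ N + 1, seriesTransform br W Z n = H n := by
  induction N with
  | zero =>
    have hhw : br h w ∈ U := by rw [eq_sub_of_add_eq hsol.symm]; exact U.sub_mem (hH 0) hz
    have htriv : IsNormalFormPair br U m h 0 (Pi.single 0 h) := by
      constructor <;> simp
    refine ⟨_, _, htriv.update 0 hw hhw hz hzm, by simp, fun n hn => ?_⟩
    interval_cases n
    · simp [seriesTransform, hH0]
    · rw [seriesTransform_update_succ, hsol]
      simp [seriesTransform, Finset.Nat.sum_antidiagonal_succ, lieTransform_one]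
  | succ N ih =>
    obtain ⟨W, Z, hWZ, hW0, heq⟩ := ih
    obtain ⟨W', Z', hWZ', hW', hZ', hlast⟩ :=
      hWZ.exists_extend hU solve (n := N + 1) (hH (N + 1))
    refine ⟨W', Z', hWZ', by rw [hW' 0 (by omega), hW0], fun n hn => ?_⟩
    rcases hn.lt_or_eq with hlt | rfl
    · rw [← heq n (by omega)]
      exact seriesTransform_congr (fun i hi => hW' i (by omega)) fun i hi => hZ' i (by omega)
    · exact hlast

/-- The Lie transform of `h` along the normalizing generators commutes with the Hamiltonian, since
`h` commutes with the normal form. -/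
theorem exists_formal_integral
    (leib : ∀ f g w, br (br f w) g + br f (br g w) = br (br f g) w)
    (hm : ∀ f ∈ m, ∀ g ∈ U, br f g ∈ m) (hh : br h h = 0) {f w z : 𝔤} (hf : f ∈ U) (hw : w ∈ U)
    (hz : z ∈ U) (hsol : f = br h w + z) (hzm : br h z ∈ m) (N : ℕ) :
    ∃ J : ℕ → 𝔤, J 0 = h ∧ J 1 = br h w ∧ (∀ n, J (n + 1) ∈ U) ∧
      ∀ n ≤ N, br (J (n + 1)) h + br (J n) f ∈ m := by
  obtain ⟨W, Z, hWZ, hW0, heq⟩ := exists_normalForm hU solve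
    (H := fun n => if n = 0 then h else if n = 1 then f else 0) (by simp)
    (fun n => by rcases n with _ | n <;> simp [hf]) hw hz (by simpa using hsol) hzm N
  refine ⟨lieTransform br W h, lieTransform_zero W h, by rw [lieTransform_one, hW0],
    lieTransform_succ_mem hU hWZ.gen_mem hWZ.br_gen_mem, fun n hn => ?_⟩
  have hZm : ∀ k, br h (Z k) ∈ m
    | 0 => by simp [hWZ.zero, hh]
    | k + 1 => hWZ.br_succ_mem k
  have hcoeff : br (lieTransform br W h (n + 1)) h + br (lieTransform br W h n) f =
      seriesBracket br (lieTransform br W h) (seriesTransform br W Z) (n + 1) := by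
    rw [seriesBracket, Finset.sum_congr rfl fun x hx => by
      rw [heq x.2 (by have := mem_antidiagonal.1 hx; omega)]]
    rcases n with _ | n <;> simp [Finset.Nat.sum_antidiagonal_succ']
  rw [hcoeff, seriesBracket_seriesTransform leib]
  exact m.sum_mem fun x _ => lieTransform_mem hm hWZ.gen_mem (hZm _) _

end NormalForm

end LieTransform

/-- The covering space `ℝ^d × ℝ^d` of the phase space. -/
abbrev Phase (d : ℕ) : Type := Momentum d × EuclideanSpace ℝ (Fin d)

/-- The vector of periods `2πn`. -/
def period {d : ℕ} (n : Fin d → ℤ) : EuclideanSpace ℝ (Fin d) :=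
  WithLp.toLp 2 fun j => 2 * Real.pi * n j

/-- Families, indexed by `I`, of smooth functions on the covering space that are periodic in the
angles. Estimates that are uniform in the scales of the problem are estimates on such families,
`I` being the set of all admissible scales. -/
def smoothFamilies (d : ℕ) (I : Type*) : Subalgebra ℂ (I → Phase d → ℂ) where
  carrier := {f | ∀ i, ContDiff ℝ ∞ (f i) ∧ ∀ n, Function.Periodic (f i) (0, period n)}
  mul_mem' hf hg i := ⟨(hf i).1.mul (hg i).1, fun n => ((hf i).2 n).mul ((hg i).2 n)⟩
  add_mem' hf hg i := ⟨(hf i).1.add (hg i).1, fun n => ((hf i).2 n).add ((hg i).2 n)⟩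
  algebraMap_mem' _ _ := ⟨contDiff_const, fun _ _ => rfl⟩

variable {d : ℕ} {I : Type*}

theorem contDiff_family (f : smoothFamilies d I) (i : I) : ContDiff ℝ ∞ (f.1 i) := (f.2 i).1

theorem differentiable_family (f : smoothFamilies d I) (i : I) : Differentiable ℝ (f.1 i) :=
  (contDiff_family f i).differentiable (by simp)

theorem periodic_family (f : smoothFamilies d I) (i : I) (n : Fin d → ℤ) :
    Function.Periodic (f.1 i) (0, period n) := (f.2 i).2 n

section PartialDerivatives

theorem periodic_fderiv {E F : Type*} [NormedAddCommGroup E] [NormedSpace ℝ E]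
    [NormedAddCommGroup F] [NormedSpace ℝ F] {f : E → F} {a : E} (hf : Function.Periodic f a) :
    Function.Periodic (fderiv ℝ f) a := fun z => by
  rw [← fderiv_comp_add_right, funext hf]

/-- The derivative in a fixed direction, as a derivation of the algebra of families. -/
def dirDeriv (v : Phase d) : Derivation ℂ (smoothFamilies d I) (smoothFamilies d I) where
  toFun f := ⟨fun i z => fderiv ℝ (f.1 i) z v, fun i =>
    ⟨((contDiff_family f i).fderiv_right (m := ∞) (by simp)).clm_apply contDiff_const,
      fun n z => congrArg (· v) (periodic_fderiv (periodic_family f i n) z)⟩⟩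
  map_add' f g := by
    ext i z
    exact DFunLike.congr_fun
      (fderiv_add (differentiable_family f i z) (differentiable_family g i z)) v
  map_smul' c f := by
    ext i z
    exact DFunLike.congr_fun (fderiv_const_smul (differentiable_family f i z) c) v
  map_one_eq_zero' := by
    ext i z
    exact DFunLike.congr_fun (fderiv_const_apply (1 : ℂ)) v
  leibniz' f g := by
    ext i z
    exact DFunLike.congr_fun
      (fderiv_mul (differentiable_family f i z) (differentiable_family g i z)) v

theorem dirDeriv_comm (u v : Phase d) (f : smoothFamilies d I) :
    dirDeriv u (dirDeriv v f) = dirDeriv v (dirDeriv u f) := by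
  ext i z
  have hdiff : Differentiable ℝ (fderiv ℝ (f.1 i)) :=
    ((contDiff_family f i).fderiv_right (m := ∞) (by simp)).differentiable (by simp)
  have hsecond (a b : Phase d) : (dirDeriv b (dirDeriv a f)).1 i z =
      fderiv ℝ (fderiv ℝ (f.1 i)) z b a := by
    change fderiv ℝ (fun z => fderiv ℝ (f.1 i) z a) z b = _
    simp [fderiv_clm_apply (hdiff z) (differentiableAt_const a)]
  rw [hsecond, hsecond]
  exact ((contDiff_family f i).contDiffAt.isSymmSndFDerivAt (by
    simpa using (WithTop.coe_le_coe (α := ℕ∞)).2 (le_top : (2 : ℕ∞) ≤ ⊤))).eq u v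

/-- The coordinate directions of the phase space: `Sum.inl j` for `p_j`, `Sum.inr j` for `q_j`. -/
def coordDir : Fin d ⊕ Fin d → Phase d
  | Sum.inl j => (EuclideanSpace.single j 1, 0)
  | Sum.inr j => (0, EuclideanSpace.single j 1)

/-- The partial derivatives `∂/∂p_j` and `∂/∂q_j` of families. -/
def pderiv (a : Fin d ⊕ Fin d) : Derivation ℂ (smoothFamilies d I) (smoothFamilies d I) :=
  dirDeriv (coordDir a)

theorem pderiv_comm (a b : Fin d ⊕ Fin d) (f : smoothFamilies d I) :
    pderiv a (pderiv b f) = pderiv b (pderiv a f) :=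
  dirDeriv_comm _ _ _

theorem pderiv_apply (a : Fin d ⊕ Fin d) (f : smoothFamilies d I) (i : I) (z : Phase d) :
    (pderiv a f).1 i z = fderiv ℝ (f.1 i) z (coordDir a) := rfl

/-- Iterated partial derivatives. -/
def iterPderiv (l : List (Fin d ⊕ Fin d)) : smoothFamilies d I →ₗ[ℂ] smoothFamilies d I :=
  l.foldr (fun a L => L ∘ₗ (pderiv a).toLinearMap) LinearMap.id

@[simp] theorem iterPderiv_nil (f : smoothFamilies d I) : iterPderiv [] f = f := rfl

@[simp] theorem iterPderiv_cons (a : Fin d ⊕ Fin d) (l : List (Fin d ⊕ Fin d))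
    (f : smoothFamilies d I) : iterPderiv (a :: l) f = iterPderiv l (pderiv a f) := rfl

end PartialDerivatives

section Poisson

/-- The Poisson bracket `∑ j, (∂f/∂q_j ∂g/∂p_j - ∂f/∂p_j ∂g/∂q_j)` of families. -/
def poisson : smoothFamilies d I →ₗ[ℂ] smoothFamilies d I →ₗ[ℂ] smoothFamilies d I :=
  LinearMap.mk₂ ℂ (fun f g => ∑ j, (pderiv (Sum.inr j) f * pderiv (Sum.inl j) g -
      pderiv (Sum.inl j) f * pderiv (Sum.inr j) g))
    (fun f f' g => by simp only [map_add, add_mul, ← Finset.sum_add_distrib]; congr! 1; ring)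
    (fun c f g => by
      simp only [Derivation.map_smul, smul_mul_assoc, Finset.smul_sum, smul_sub])
    (fun f g g' => by simp only [map_add, mul_add, ← Finset.sum_add_distrib]; congr! 1; ring)
    (fun c f g => by
      simp only [Derivation.map_smul, mul_smul_comm, Finset.smul_sum, smul_sub])

theorem poisson_def (f g : smoothFamilies d I) : poisson f g =
    ∑ j, (pderiv (Sum.inr j) f * pderiv (Sum.inl j) g -
      pderiv (Sum.inl j) f * pderiv (Sum.inr j) g) := rfl

theorem poisson_self (f : smoothFamilies d I) : poisson f f = 0 := by
  rw [poisson_def]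
  exact Finset.sum_eq_zero fun _ _ => by ring

theorem sum_sum_eq_zero_of_add_swap_eq_zero {ι A : Type*} [Fintype ι] [AddCommGroup A]
    [Module ℂ A] {F : ι → ι → A} (h : ∀ j k, F j k + F k j = 0) :
    ∑ j, ∑ k, F j k = 0 := by
  have htwice : (2 : ℂ) • ∑ j, ∑ k, F j k = 0 := by
    rw [two_smul]
    nth_rewrite 2 [Finset.sum_comm]
    simp only [← Finset.sum_add_distrib, h, Finset.sum_const_zero]
  exact (smul_eq_zero_iff_right two_ne_zero).1 htwice

/-- The second derivatives cancel in pairs. -/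
theorem poisson_jacobi (f g w : smoothFamilies d I) :
    poisson (poisson f w) g + poisson f (poisson g w) = poisson (poisson f g) w := by
  rw [poisson_def (poisson f w) g, poisson_def f (poisson g w), poisson_def (poisson f g) w]
  simp only [poisson_def, map_sum, map_sub, Derivation.leibniz, smul_eq_mul, Finset.sum_mul,
    Finset.mul_sum, ← Finset.sum_sub_distrib]
  rw [← sub_eq_zero, ← Finset.sum_add_distrib, ← Finset.sum_sub_distrib]
  simp only [← Finset.sum_add_distrib, ← Finset.sum_sub_distrib]
  refine sum_sum_eq_zero_of_add_swap_eq_zero fun j k => ?_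
  simp only [pderiv_comm (Sum.inr j) (Sum.inr k), pderiv_comm (Sum.inr j) (Sum.inl k),
    pderiv_comm (Sum.inl j) (Sum.inl k), pderiv_comm (Sum.inl j) (Sum.inr k)]
  ring

end Poisson

section UniformBounds

/-- Uniform boundedness of a family over the momenta in the unit ball. -/
def UniformlyBounded (f : smoothFamilies d I) : Prop :=
  ∃ C : ℝ, ∀ i (z : Phase d), ‖z.1‖ ≤ 1 → ‖f.1 i z‖ ≤ C

theorem UniformlyBounded.add {f g : smoothFamilies d I} (hf : UniformlyBounded f)
    (hg : UniformlyBounded g) : UniformlyBounded (f + g) := by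
  obtain ⟨C, hC⟩ := hf
  obtain ⟨D, hD⟩ := hg
  exact ⟨C + D, fun i z hz => norm_add_le_of_le (hC i z hz) (hD i z hz)⟩

theorem UniformlyBounded.mul {f g : smoothFamilies d I} (hf : UniformlyBounded f)
    (hg : UniformlyBounded g) : UniformlyBounded (f * g) := by
  obtain ⟨C, hC⟩ := hf
  obtain ⟨D, hD⟩ := hg
  exact ⟨C * D, fun i z hz => norm_mul_le_of_le (hC i z hz) (hD i z hz)⟩

/-- Families all of whose derivatives are uniformly bounded over the momenta in the unit ball. -/
def uniformFamilies (d : ℕ) (I : Type*) : Subalgebra ℂ (smoothFamilies d I) where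
  carrier := {f | ∀ l, UniformlyBounded (iterPderiv l f)}
  add_mem' hf hg l := by rw [map_add]; exact (hf l).add (hg l)
  mul_mem' {f g} hf hg l := by
    induction l generalizing f g with
    | nil => exact (hf []).mul (hg [])
    | cons a l ih =>
      rw [iterPderiv_cons, Derivation.leibniz, map_add, smul_eq_mul, smul_eq_mul]
      exact (ih hf fun l => hg (a :: l)).add (ih hg fun l => hf (a :: l))
  algebraMap_mem' c
    | [] => ⟨‖c‖, fun _ _ _ => le_rfl⟩
    | a :: _ => ⟨0, fun _ _ _ => by simp⟩

theorem uniformlyBounded_of_mem {f : smoothFamilies d I} (hf : f ∈ uniformFamilies d I) :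
    UniformlyBounded f := hf []

theorem pderiv_mem_uniformFamilies {f : smoothFamilies d I} (hf : f ∈ uniformFamilies d I)
    (a : Fin d ⊕ Fin d) : pderiv a f ∈ uniformFamilies d I := fun l => hf (a :: l)

theorem iterPderiv_mem_uniformFamilies {f : smoothFamilies d I} (hf : f ∈ uniformFamilies d I)
    (l : List (Fin d ⊕ Fin d)) : iterPderiv l f ∈ uniformFamilies d I := by
  induction l generalizing f with
  | nil => exact hf
  | cons a _ ih => exact ih (pderiv_mem_uniformFamilies hf a)

theorem mem_uniformFamilies_of_pderiv {f : smoothFamilies d I} (h0 : UniformlyBounded f)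
    (h : ∀ a, pderiv a f ∈ uniformFamilies d I) : f ∈ uniformFamilies d I
  | [] => h0
  | a :: l => h a l

theorem poisson_mem_uniformFamilies {f g : smoothFamilies d I} (hf : f ∈ uniformFamilies d I)
    (hg : g ∈ uniformFamilies d I) : poisson f g ∈ uniformFamilies d I := by
  rw [poisson_def]
  exact sum_mem fun _ _ => sub_mem
    (mul_mem (pderiv_mem_uniformFamilies hf _) (pderiv_mem_uniformFamilies hg _))
    (mul_mem (pderiv_mem_uniformFamilies hf _) (pderiv_mem_uniformFamilies hg _))

end UniformBounds

section Constants

/-- The family of constants given by a function of the index. -/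
def constFamily : (I → ℝ) →+* smoothFamilies d I where
  toFun c := ⟨fun i _ => (c i : ℂ), fun _ => ⟨contDiff_const, fun _ _ => rfl⟩⟩
  map_one' := by ext; exact Complex.ofReal_one
  map_mul' c e := by ext i; exact Complex.ofReal_mul (c i) (e i)
  map_zero' := by ext; exact Complex.ofReal_zero
  map_add' c e := by ext i; exact Complex.ofReal_add (c i) (e i)

@[simp] theorem constFamily_apply (c : I → ℝ) (i : I) (z : Phase d) :
    (constFamily c : smoothFamilies d I).1 i z = c i := rfl

@[simp] theorem pderiv_constFamily (a : Fin d ⊕ Fin d) (c : I → ℝ) :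
    pderiv a (constFamily c : smoothFamilies d I) = 0 := by
  ext i _
  exact DFunLike.congr_fun (fderiv_const_apply (c i : ℂ)) (coordDir a)

theorem pderiv_constFamily_mul (a : Fin d ⊕ Fin d) (c : I → ℝ) (f : smoothFamilies d I) :
    pderiv a (constFamily c * f) = constFamily c * pderiv a f := by
  simp [Derivation.leibniz]

theorem iterPderiv_constFamily_mul (l : List (Fin d ⊕ Fin d)) (c : I → ℝ)
    (f : smoothFamilies d I) :
    iterPderiv l (constFamily c * f) = constFamily c * iterPderiv l f := by
  induction l generalizing f with
  | nil => rfl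
  | cons a l ih => rw [iterPderiv_cons, iterPderiv_cons, pderiv_constFamily_mul, ih]

theorem poisson_constFamily_mul_right (c : I → ℝ) (f g : smoothFamilies d I) :
    poisson f (constFamily c * g) = constFamily c * poisson f g := by
  simp only [poisson_def, pderiv_constFamily_mul, Finset.mul_sum]
  exact Finset.sum_congr rfl fun j _ => by ring

theorem poisson_constFamily_mul_left (c : I → ℝ) (f g : smoothFamilies d I) :
    poisson (constFamily c * f) g = constFamily c * poisson f g := by
  simp only [poisson_def, pderiv_constFamily_mul, Finset.mul_sum]
  exact Finset.sum_congr rfl fun j _ => by ring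

theorem constFamily_mem_uniformFamilies {c : I → ℝ} {C : ℝ} (hc : ∀ i, |c i| ≤ C) :
    (constFamily c : smoothFamilies d I) ∈ uniformFamilies d I :=
  mem_uniformFamilies_of_pderiv
    ⟨C, fun i _ _ => by rw [constFamily_apply, Complex.norm_real]; exact hc i⟩
    fun a => by rw [pderiv_constFamily]; exact zero_mem _

/-- Families that are smaller than every power of `1 / X`, with all their derivatives. -/
def negligibleFamilies (d : ℕ) (X : I → ℝ) : Submodule ℂ (smoothFamilies d I) where
  carrier := {f | ∀ n : ℕ, constFamily X ^ n * f ∈ uniformFamilies d I}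
  add_mem' hf hg n := by rw [mul_add]; exact add_mem (hf n) (hg n)
  zero_mem' n := by rw [mul_zero]; exact zero_mem _
  smul_mem' c f hf n := by rw [mul_smul_comm]; exact (uniformFamilies d I).smul_mem (hf n) c

theorem poisson_mem_negligibleFamilies {X : I → ℝ} {f g : smoothFamilies d I}
    (hf : f ∈ negligibleFamilies d X) (hg : g ∈ uniformFamilies d I) :
    poisson f g ∈ negligibleFamilies d X := fun n => by
  rw [← map_pow, ← poisson_constFamily_mul_left, map_pow]
  exact poisson_mem_uniformFamilies (hf n) hg

end Constants

section Momenta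

/-- The coordinate function `p_j`. -/
def momentumCoord (j : Fin d) : smoothFamilies d I :=
  ⟨fun _ z => ((z.1 j : ℝ) : ℂ), fun _ => ⟨Complex.ofRealCLM.contDiff.comp (by fun_prop),
    fun _ _ => by simp⟩⟩

theorem pderiv_momentumCoord (a : Fin d ⊕ Fin d) (j : Fin d) :
    pderiv a (momentumCoord j : smoothFamilies d I) = constFamily fun _ => (coordDir a).1 j := by
  ext
  let L : Phase d →L[ℝ] ℂ := Complex.ofRealCLM ∘L (EuclideanSpace.proj j) ∘L
    (ContinuousLinearMap.fst ℝ (Momentum d) (EuclideanSpace ℝ (Fin d)))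
  exact DFunLike.congr_fun L.fderiv (coordDir a)

theorem pderiv_inl_momentumCoord (j k : Fin d) :
    pderiv (Sum.inl k) (momentumCoord j : smoothFamilies d I) = if j = k then 1 else 0 := by
  rw [pderiv_momentumCoord]
  ext i z
  by_cases h : j = k <;> simp [coordDir, h]

theorem pderiv_inr_momentumCoord (j k : Fin d) :
    pderiv (Sum.inr k) (momentumCoord j : smoothFamilies d I) = 0 := by
  rw [pderiv_momentumCoord]
  ext
  simp [coordDir]

theorem momentumCoord_mem_uniformFamilies (j : Fin d) :
    (momentumCoord j : smoothFamilies d I) ∈ uniformFamilies d I := by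
  refine mem_uniformFamilies_of_pderiv ⟨1, fun _ z hz => ?_⟩ fun a => ?_
  · exact (Complex.norm_real _).trans_le ((PiLp.norm_apply_le z.1 j).trans hz)
  · rw [pderiv_momentumCoord]
    exact constFamily_mem_uniformFamilies fun _ => le_rfl

/-- The kinetic energy `|p|² / 2`. -/
def kinetic : smoothFamilies d I := (2⁻¹ : ℂ) • ∑ j, momentumCoord j * momentumCoord j

theorem kinetic_mem_uniformFamilies : (kinetic : smoothFamilies d I) ∈ uniformFamilies d I :=
  (uniformFamilies d I).smul_mem (sum_mem fun j _ =>
    mul_mem (momentumCoord_mem_uniformFamilies j) (momentumCoord_mem_uniformFamilies j)) _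

theorem pderiv_inr_kinetic (k : Fin d) :
    pderiv (Sum.inr k) (kinetic : smoothFamilies d I) = 0 := by
  simp [kinetic, map_sum, Derivation.leibniz, pderiv_inr_momentumCoord]

/-- The linear Hamiltonian `v · p`, which generates the linear flow `q ↦ q + t v`. -/
def linearHam (v : I → Momentum d) : smoothFamilies d I :=
  ∑ j, constFamily (fun i => v i j) * momentumCoord j

theorem pderiv_inl_linearHam (v : I → Momentum d) (k : Fin d) :
    pderiv (Sum.inl k) (linearHam v) = constFamily fun i => v i k := by
  simp [linearHam, map_sum, pderiv_inl_momentumCoord]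

theorem pderiv_inr_linearHam (v : I → Momentum d) (k : Fin d) :
    pderiv (Sum.inr k) (linearHam v) = 0 := by
  simp [linearHam, map_sum, pderiv_inr_momentumCoord]

theorem poisson_linearHam (v : I → Momentum d) (f : smoothFamilies d I) :
    poisson (linearHam v) f = -∑ j, constFamily (fun i => v i j) * pderiv (Sum.inr j) f := by
  simp [poisson_def, pderiv_inl_linearHam, pderiv_inr_linearHam]

theorem poisson_linearHam_kinetic (v : I → Momentum d) : poisson (linearHam v) kinetic = 0 := by
  simp [poisson_linearHam, pderiv_inr_kinetic]

end Momenta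

open MeasureTheory UnitAddTorus

section Averages

universe u

variable {Θ : Type*} [MeasurableSpace Θ] (μ : Measure Θ) [IsFiniteMeasure μ] {E F : Type u}
  [NormedAddCommGroup E] [ProperSpace E] [NormedAddCommGroup F] {c : Θ → ℂ} {s : Θ → E} {R : ℝ}

theorem exists_norm_translate_le {G : E → F} (hG : Continuous G) (z : E) (R : ℝ) :
    ∃ C, ∀ x ∈ Metric.ball z 1, ∀ y, ‖y‖ ≤ R → ‖G (x + y)‖ ≤ C := by
  obtain ⟨C, hC⟩ :=
    ((isCompact_closedBall (0 : E) (‖z‖ + 1 + R)).image hG).isBounded.exists_norm_le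
  refine ⟨C, fun x hx y hy => hC _ ⟨x + y, ?_, rfl⟩⟩
  rw [mem_closedBall_zero_iff]
  rw [mem_ball_iff_norm] at hx
  have hxz : ‖x‖ ≤ ‖z‖ + 1 := by linarith [norm_sub_norm_le x z]
  exact norm_add_le_of_le hxz hy

variable [NormedSpace ℂ F]

theorem norm_smul_le_of_norm_le_one {a : ℂ} {x : F} {C : ℝ} (ha : ‖a‖ ≤ 1) (hx : ‖x‖ ≤ C) :
    ‖a • x‖ ≤ C := by
  rw [norm_smul]
  exact (mul_le_of_le_one_left (norm_nonneg x) ha).trans hx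

theorem integrable_smul_translate (hc : StronglyMeasurable c) (hc1 : ∀ θ, ‖c θ‖ ≤ 1)
    (hs : StronglyMeasurable s) (hsR : ∀ θ, ‖s θ‖ ≤ R) {G : E → F} (hG : Continuous G) (z : E) :
    Integrable (fun θ => c θ • G (z + s θ)) μ := by
  obtain ⟨C, hC⟩ := exists_norm_translate_le hG z R
  refine Integrable.of_bound (C := C) ?_ (Filter.Eventually.of_forall fun θ =>
    norm_smul_le_of_norm_le_one (hc1 θ) (hC z (Metric.mem_ball_self one_pos) _ (hsR θ)))
  exact (hc.smul (hG.comp_stronglyMeasurable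
    (stronglyMeasurable_const.add hs))).aestronglyMeasurable

variable [NormedSpace ℝ E] [NormedSpace ℝ F] [SMulCommClass ℝ ℂ F]

theorem hasFDerivAt_integral_translate (hc : StronglyMeasurable c) (hc1 : ∀ θ, ‖c θ‖ ≤ 1)
    (hs : StronglyMeasurable s) (hsR : ∀ θ, ‖s θ‖ ≤ R) {G : E → F} (hG : ContDiff ℝ 1 G)
    (z : E) : HasFDerivAt (fun z => ∫ θ, c θ • G (z + s θ) ∂μ)
      (∫ θ, c θ • fderiv ℝ G (z + s θ) ∂μ) z := by
  have hG' : Continuous (fderiv ℝ G) := hG.continuous_fderiv (by simp)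
  obtain ⟨C, hC⟩ := exists_norm_translate_le hG' z R
  have hint {E' : Type u} [NormedAddCommGroup E'] [NormedSpace ℂ E'] {G' : E → E'}
      (h : Continuous G') (x : E) : Integrable (fun θ => c θ • G' (x + s θ)) μ :=
    integrable_smul_translate μ hc hc1 hs hsR h x
  refine hasFDerivAt_integral_of_dominated_of_fderiv_le (𝕜 := ℝ) (bound := fun _ => C)
    (F' := fun z θ => c θ • fderiv ℝ G (z + s θ))
    (Metric.ball_mem_nhds z one_pos)
    (Filter.Eventually.of_forall fun x => (hint hG.continuous x).aestronglyMeasurable)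
    (hint hG.continuous z) (hint hG' z).aestronglyMeasurable
    (Filter.Eventually.of_forall fun θ x hx =>
      norm_smul_le_of_norm_le_one (hc1 θ) (hC x hx _ (hsR θ)))
    (integrable_const _) (Filter.Eventually.of_forall fun θ x _ => ?_)
  have hderiv := (hG.differentiable (by simp) (x + s θ)).hasFDerivAt
  exact ((hasFDerivAt_comp_add_right (s θ)).2 hderiv).const_smul (c θ)

theorem contDiff_integral_translate (hc : StronglyMeasurable c) (hc1 : ∀ θ, ‖c θ‖ ≤ 1)
    (hs : StronglyMeasurable s) (hsR : ∀ θ, ‖s θ‖ ≤ R) {G : E → F} (hG : ContDiff ℝ ∞ G) :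
    ContDiff ℝ ∞ (fun z => ∫ θ, c θ • G (z + s θ) ∂μ) := by
  refine contDiff_infty.2 fun n => ?_
  induction n generalizing F with
  | zero =>
    exact contDiff_zero.2 (Differentiable.continuous (𝕜 := ℝ) fun z =>
      (hasFDerivAt_integral_translate μ hc hc1 hs hsR
        (hG.of_le (by exact_mod_cast le_top)) z).differentiableAt)
  | succ n ih =>
    have hderiv := hasFDerivAt_integral_translate μ hc hc1 hs hsR
      (hG.of_le (by exact_mod_cast le_top))
    refine (contDiff_succ_iff_fderiv (n := n)).2
      ⟨fun z => (hderiv z).differentiableAt, by simp, ?_⟩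
    rw [funext fun z => (hderiv z).fderiv]
    exact ih (hG.fderiv_right (m := ∞) (by simp))

end Averages

section TorusSection

/-- The normalized Haar measure of the torus. -/
def torusMeasure (d : ℕ) : Measure (UnitAddTorus (Fin d)) :=
  Measure.pi fun _ => AddCircle.haarAddCircle

instance : IsProbabilityMeasure (torusMeasure d) :=
  inferInstanceAs (IsProbabilityMeasure (Measure.pi fun _ : Fin d => AddCircle.haarAddCircle))

instance : (torusMeasure d).IsAddHaarMeasure :=
  inferInstanceAs (Measure.IsAddHaarMeasure (Measure.pi fun _ : Fin d => AddCircle.haarAddCircle))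

/-- The projection of the space of angles onto the unit torus; the unit is the period `2π`. -/
def toUnitTorus (q : EuclideanSpace ℝ (Fin d)) : UnitAddTorus (Fin d) :=
  fun j => ((q j / (2 * Real.pi) : ℝ) : UnitAddCircle)

/-- The section of `toUnitTorus` with values in the cube `(0, 2π]^d`. -/
def torusSection (θ : UnitAddTorus (Fin d)) : EuclideanSpace ℝ (Fin d) :=
  WithLp.toLp 2 fun j => 2 * Real.pi * (measurableEquivPiIoc 0 θ).1 j

theorem toUnitTorus_add (q r : EuclideanSpace ℝ (Fin d)) :
    toUnitTorus (q + r) = toUnitTorus q + toUnitTorus r := by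
  ext j
  simp [toUnitTorus, add_div]

theorem toUnitTorus_torusSection (θ : UnitAddTorus (Fin d)) :
    toUnitTorus (torusSection θ) = θ := by
  ext j
  simp only [toUnitTorus, torusSection, mul_div_cancel_left₀ _ Real.two_pi_pos.ne']
  exact congrFun ((measurableEquivPiIoc 0).symm_apply_apply θ) j

theorem stronglyMeasurable_torusSection : StronglyMeasurable
    (fun θ : UnitAddTorus (Fin d) => ((0, torusSection θ) : Phase d)) := by
  have hval := measurable_subtype_coe.comp (measurableEquivPiIoc (0 : Fin d → ℝ)).measurable
  have hsection : Measurable (torusSection : UnitAddTorus (Fin d) → _) :=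
    (WithLp.measurable_toLp 2 _).comp
      (measurable_pi_lambda _ fun j => ((measurable_pi_apply j).comp hval).const_mul _)
  exact stronglyMeasurable_const.prodMk hsection.stronglyMeasurable

theorem exists_norm_torusSection_le (d : ℕ) :
    ∃ R : ℝ, ∀ θ : UnitAddTorus (Fin d), ‖((0, torusSection θ) : Phase d)‖ ≤ R := by
  obtain ⟨R, hR⟩ := (isCompact_univ_pi fun _ : Fin d =>
    isCompact_Icc (a := (0 : ℝ)) (b := 2 * Real.pi)).image (PiLp.continuous_toLp 2 fun _ => ℝ)
      |>.isBounded.exists_norm_le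
  refine ⟨R, fun θ => ?_⟩
  rw [Prod.norm_mk, norm_zero, max_eq_right (norm_nonneg _)]
  refine hR _ ⟨_, fun j _ => ?_, rfl⟩
  obtain ⟨hpos, hle⟩ := (measurableEquivPiIoc 0 θ).2 j
  have hpi := Real.two_pi_pos
  exact ⟨mul_nonneg hpi.le hpos.le, mul_le_of_le_one_right hpi.le (by simpa using hle)⟩

theorem exists_period_of_toUnitTorus_eq {q r : EuclideanSpace ℝ (Fin d)}
    (h : toUnitTorus q = toUnitTorus r) : ∃ n, r = q + period n := by
  have hcoord (j : Fin d) : ∃ n : ℤ, r j = q j + 2 * Real.pi * n := by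
    have hzero : ((r j / (2 * Real.pi) - q j / (2 * Real.pi) : ℝ) : UnitAddCircle) = 0 := by
      rw [AddCircle.coe_sub, sub_eq_zero]
      exact (congrFun h j).symm
    obtain ⟨n, hn⟩ := (AddCircle.coe_eq_zero_iff 1).1 hzero
    rw [zsmul_eq_mul, mul_one, ← sub_div, eq_div_iff Real.two_pi_pos.ne'] at hn
    exact ⟨n, by linarith⟩
  choose n hn using hcoord
  exact ⟨n, by ext j; simp [period, hn]⟩

theorem family_eq_of_toUnitTorus_eq (f : smoothFamilies d I) (i : I) {z w : Phase d}
    (hp : z.1 = w.1) (hq : toUnitTorus z.2 = toUnitTorus w.2) : f.1 i z = f.1 i w := by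
  obtain ⟨n, hn⟩ := exists_period_of_toUnitTorus_eq hq
  have hw : w = z + (0, period n) := Prod.ext (by simp [hp]) hn
  rw [hw, periodic_family f i n z]

theorem continuous_family_torusSection (f : smoothFamilies d I) (i : I) (z : Phase d) :
    Continuous fun θ : UnitAddTorus (Fin d) => f.1 i (z + (0, torusSection θ)) := by
  have hquot : IsOpenQuotientMap (Pi.map fun _ : Fin d => ((↑) : ℝ → UnitAddCircle)) :=
    IsOpenQuotientMap.piMap fun _ => QuotientAddGroup.isOpenQuotientMap_mk
  refine hquot.isQuotientMap.continuous_iff.2 ?_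
  have hlift (x : Fin d → ℝ) : f.1 i (z + (0, torusSection (Pi.map (fun _ => (↑)) x))) =
      f.1 i (z + (0, (2 * Real.pi) • WithLp.toLp 2 x)) := by
    refine family_eq_of_toUnitTorus_eq f i rfl ?_
    rw [Prod.snd_add, Prod.snd_add, toUnitTorus_add, toUnitTorus_add, toUnitTorus_torusSection]
    ext j
    simp [toUnitTorus, mul_div_cancel_left₀ _ Real.two_pi_pos.ne']
  refine Continuous.congr ?_ fun x => (hlift x).symm
  exact (contDiff_family f i).continuous.comp (continuous_const.add (continuous_const.prodMk
    ((PiLp.continuous_toLp 2 fun _ => ℝ).const_smul (2 * Real.pi))))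

end TorusSection

section FourierModes

theorem mFourier_add_apply (k : Fin d → ℤ) (θ φ : UnitAddTorus (Fin d)) :
    mFourier k (θ + φ) = mFourier k θ * mFourier k φ := by
  simp [mFourier, ← Finset.prod_mul_distrib, fourier_apply, AddCircle.toCircle_add]

theorem norm_mFourier_apply (k : Fin d → ℤ) (θ : UnitAddTorus (Fin d)) : ‖mFourier k θ‖ = 1 := by
  rw [mFourier, ContinuousMap.coe_mk, norm_prod]
  exact Finset.prod_eq_one fun _ _ => Circle.norm_coe _

/-- The pairing `∑ j, k_j v_j` of a frequency with a vector. -/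
def dot (k : Fin d → ℤ) (v : EuclideanSpace ℝ (Fin d)) : ℝ := ∑ j, k j * v j

theorem mFourier_toUnitTorus (k : Fin d → ℤ) (q : EuclideanSpace ℝ (Fin d)) :
    mFourier k (toUnitTorus q) = Complex.exp (Complex.I * dot k q) := by
  have hpi : (Real.pi : ℂ) ≠ 0 := by exact_mod_cast Real.pi_ne_zero
  simp only [mFourier, ContinuousMap.coe_mk, toUnitTorus, fourier_coe_apply, dot,
    ← Complex.exp_sum, Complex.ofReal_sum, Finset.mul_sum]
  congr! 2 with j
  push_cast
  field_simp

/-- The Fourier mode `f_k(p) exp(i k·q)` of a family, obtained by averaging the translates of the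
family in the angles against `exp(-i k·θ)`. -/
def mode (k : Fin d → ℤ) (f : smoothFamilies d I) : smoothFamilies d I :=
  ⟨fun i z => mFourierCoeff (fun θ => f.1 i (z + (0, torusSection θ))) k, fun i => by
    obtain ⟨R, hR⟩ := exists_norm_torusSection_le d
    refine ⟨contDiff_integral_translate (torusMeasure d)
      (mFourier (-k)).continuous.stronglyMeasurable (fun θ => (norm_mFourier_apply _ θ).le)
      stronglyMeasurable_torusSection hR (contDiff_family f i), fun n z => ?_⟩
    refine congrArg (mFourierCoeff · k) (funext fun θ => ?_)
    rw [add_right_comm, periodic_family]⟩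

theorem mode_apply (k : Fin d → ℤ) (f : smoothFamilies d I) (i : I) (z : Phase d) :
    (mode k f).1 i z = ∫ θ, mFourier (-k) θ • f.1 i (z + (0, torusSection θ)) ∂torusMeasure d :=
  rfl

theorem pderiv_mode (a : Fin d ⊕ Fin d) (k : Fin d → ℤ) (f : smoothFamilies d I) :
    pderiv a (mode k f) = mode k (pderiv a f) := by
  ext i z
  obtain ⟨R, hR⟩ := exists_norm_torusSection_le d
  have hf : ContDiff ℝ 1 (f.1 i) := (contDiff_family f i).of_le (by exact_mod_cast le_top)
  have hmeas := (mFourier (-k)).continuous.stronglyMeasurable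
  have hnorm := fun θ => (norm_mFourier_apply (-k) θ).le
  have hderiv := hasFDerivAt_integral_translate (torusMeasure d) hmeas hnorm
    stronglyMeasurable_torusSection hR hf z
  have hint := integrable_smul_translate (torusMeasure d) hmeas hnorm
    stronglyMeasurable_torusSection hR (hf.continuous_fderiv (by simp)) z
  rw [pderiv_apply, mode_apply]
  exact (DFunLike.congr_fun hderiv.fderiv _).trans (ContinuousLinearMap.integral_apply hint _)

theorem mode_translate (k : Fin d → ℤ) (f : smoothFamilies d I) (i : I) (z : Phase d)
    (r : EuclideanSpace ℝ (Fin d)) :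
    (mode k f).1 i (z + (0, r)) = Complex.exp (Complex.I * dot k r) * (mode k f).1 i z := by
  let g (θ : UnitAddTorus (Fin d)) : ℂ := mFourier (-k) θ • f.1 i (z + (0, torusSection θ))
  have hshift (θ : UnitAddTorus (Fin d)) :
      f.1 i (z + (0, r) + (0, torusSection θ)) =
        f.1 i (z + (0, torusSection (θ + toUnitTorus r))) := by
    refine family_eq_of_toUnitTorus_eq f i (by simp) ?_
    simp only [Prod.snd_add, toUnitTorus_add, toUnitTorus_torusSection, add_assoc, add_comm]
  have hcharacter (θ : UnitAddTorus (Fin d)) : mFourier (-k) θ =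
      mFourier k (toUnitTorus r) * mFourier (-k) (θ + toUnitTorus r) := by
    rw [mFourier_add_apply, mul_left_comm, ← mFourier_add]
    simp [mFourier_zero]
  have hint (θ : UnitAddTorus (Fin d)) :
      mFourier (-k) θ • f.1 i (z + (0, r) + (0, torusSection θ)) =
        mFourier k (toUnitTorus r) • g (θ + toUnitTorus r) := by
    rw [hshift, hcharacter, mul_smul]
  rw [mode_apply, mode_apply, funext hint, integral_smul, integral_add_right_eq_self g,
    smul_eq_mul, mFourier_toUnitTorus]

theorem pderiv_inr_mode (k : Fin d → ℤ) (j : Fin d) (f : smoothFamilies d I) :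
    pderiv (Sum.inr j) (mode k f) = (Complex.I * k j) • mode k f := by
  ext i z
  have hline (t : ℝ) : (mode k f).1 i (z + t • coordDir (Sum.inr j)) =
      Complex.exp (Complex.I * (k j * t : ℝ)) * (mode k f).1 i z := by
    have hdir : t • coordDir (Sum.inr j) = ((0, t • EuclideanSpace.single j 1) : Phase d) := by
      simp [coordDir]
    rw [hdir, mode_translate]
    simp [dot]
  have hlin : HasDerivAt (fun t : ℝ => ((k j * t : ℝ) : ℂ)) (k j) 0 := by
    simpa using ((hasDerivAt_id (0 : ℝ)).const_mul (k j : ℝ)).ofReal_comp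
  rw [pderiv_apply, ← (differentiable_family (mode k f) i z).lineDeriv_eq_fderiv, lineDeriv,
    funext hline, ((hlin.const_mul Complex.I).cexp.mul_const _).deriv]
  simp

theorem norm_mode_le (k : Fin d → ℤ) {f : smoothFamilies d I} {i : I} {z : Phase d} {C : ℝ}
    (h : ∀ z' : Phase d, z'.1 = z.1 → ‖f.1 i z'‖ ≤ C) : ‖(mode k f).1 i z‖ ≤ C := by
  rw [mode_apply]
  simpa using norm_integral_le_of_norm_le_const (μ := torusMeasure d)
    (Filter.Eventually.of_forall fun θ =>
      norm_smul_le_of_norm_le_one (norm_mFourier_apply (-k) θ).le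
        (h (z + (0, torusSection θ)) (by simp)))

theorem mode_iterPderiv_replicate (k : Fin d → ℤ) (j : Fin d) (m : ℕ) (f : smoothFamilies d I) :
    mode k (iterPderiv (List.replicate m (Sum.inr j)) f) =
      (Complex.I * k j) ^ m • mode k f := by
  induction m generalizing f with
  | zero => simp
  | succ m ih =>
    rw [List.replicate_succ, iterPderiv_cons, ih, ← pderiv_mode, pderiv_inr_mode, smul_smul,
      pow_succ]

end FourierModes

section FourierSeries

theorem one_add_norm_pow_le (k : Fin d → ℤ) (m : ℕ) :
    (1 + ‖k‖) ^ m ≤ 2 ^ m * (1 + ∑ j, ‖k j‖ ^ m) := by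
  have hsum : 0 ≤ ∑ j, ‖k j‖ ^ m := by positivity
  rcases le_or_gt ‖k‖ 1 with hk | hk
  · calc (1 + ‖k‖) ^ m ≤ 2 ^ m := by gcongr; linarith
      _ ≤ 2 ^ m * (1 + ∑ j, ‖k j‖ ^ m) := le_mul_of_one_le_right (by positivity) (by linarith)
  · obtain ⟨j, hj⟩ : ∃ j, ‖k‖ ≤ ‖k j‖ := by
      by_contra! hlt
      exact ((pi_norm_lt_iff (one_pos.trans hk)).2 hlt).false
    calc (1 + ‖k‖) ^ m ≤ (2 * ‖k j‖) ^ m := by gcongr; linarith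
      _ = 2 ^ m * ‖k j‖ ^ m := mul_pow _ _ _
      _ ≤ 2 ^ m * (1 + ∑ j, ‖k j‖ ^ m) := by
        gcongr
        exact (Finset.single_le_sum (f := fun j => ‖k j‖ ^ m) (fun _ _ => by positivity)
          (Finset.mem_univ j)).trans (by linarith)

theorem exists_mode_decay {f : smoothFamilies d I} (hf : f ∈ uniformFamilies d I) (m : ℕ) :
    ∃ C : ℝ, ∀ (k : Fin d → ℤ) (i : I) (z : Phase d), ‖z.1‖ ≤ 1 →
      (1 + ‖k‖) ^ m * ‖(mode k f).1 i z‖ ≤ C := by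
  obtain ⟨C₀, hC₀⟩ := uniformlyBounded_of_mem hf
  choose C hC using fun j => hf (List.replicate m (Sum.inr j))
  refine ⟨2 ^ m * (C₀ + ∑ j, C j), fun k i z hz => ?_⟩
  have hzero : ‖(mode k f).1 i z‖ ≤ C₀ := norm_mode_le k fun z' hz' => hC₀ i z' (hz' ▸ hz)
  have hcoord (j : Fin d) : ‖k j‖ ^ m * ‖(mode k f).1 i z‖ ≤ C j := by
    have hmode := norm_mode_le k (z := z) fun z' hz' => hC j i z' (hz' ▸ hz)
    rw [mode_iterPderiv_replicate] at hmode
    calc ‖k j‖ ^ m * ‖(mode k f).1 i z‖ = ‖(Complex.I * k j) ^ m • (mode k f).1 i z‖ := by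
          simp [Int.norm_eq_abs]
      _ ≤ C j := hmode
  calc (1 + ‖k‖) ^ m * ‖(mode k f).1 i z‖
      ≤ 2 ^ m * (1 + ∑ j, ‖k j‖ ^ m) * ‖(mode k f).1 i z‖ := by
        gcongr
        exact one_add_norm_pow_le k m
    _ = 2 ^ m * (‖(mode k f).1 i z‖ + ∑ j, ‖k j‖ ^ m * ‖(mode k f).1 i z‖) := by
        rw [mul_assoc, add_mul, one_mul, Finset.sum_mul]
    _ ≤ 2 ^ m * (C₀ + ∑ j, C j) := by
        gcongr with j
        exact hcoord j

theorem summable_inv_one_add_norm_pow (d : ℕ) :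
    Summable fun k : Fin d → ℤ => ((1 + ‖k‖) ^ (d + 1))⁻¹ := by
  let b := Pi.basisFun ℝ (Fin d)
  let L := Submodule.span ℤ (Set.range b)
  let e : (Fin d → ℤ) ≃ₗ[ℤ] L := (b.restrictScalars ℤ).equivFun.symm
  have hrank : Module.finrank ℤ L = d := by
    simpa using Module.finrank_eq_card_basis (b.restrictScalars ℤ)
  have hnorm (k : Fin d → ℤ) : ‖e k‖ = ‖k‖ := by
    have hk : (e k : Fin d → ℝ) = fun j => (k j : ℝ) := by
      ext j
      simp [e, Module.Basis.equivFun_symm_apply, b, Pi.single_apply]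
    rw [← Submodule.norm_coe, hk]
    rfl
  have hsum := (ZLattice.summable_norm_pow_inv L (d + 1) (by omega)).comp_injective e.injective
  refine Summable.of_norm_bounded_eventually hsum ?_
  refine (Set.finite_singleton (0 : Fin d → ℤ)).subset fun k hk => ?_
  by_contra hne
  refine hk ?_
  have : 0 < ‖k‖ := norm_pos_iff.2 hne
  change ‖((1 + ‖k‖) ^ (d + 1))⁻¹‖ ≤ ‖e k‖⁻¹ ^ (d + 1)
  rw [Real.norm_of_nonneg (by positivity), hnorm, inv_pow]
  gcongr
  linarith

theorem exists_summable_mode {f : smoothFamilies d I} (hf : f ∈ uniformFamilies d I) (m : ℕ) :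
    ∃ u : (Fin d → ℤ) → ℝ, Summable u ∧ (∀ k, 0 ≤ u k) ∧
      ∀ (k : Fin d → ℤ) (i : I) (z : Phase d), ‖z.1‖ ≤ 1 →
        (1 + ‖k‖) ^ m * ‖(mode k f).1 i z‖ ≤ u k := by
  obtain ⟨C, hC⟩ := exists_mode_decay hf (m + (d + 1))
  refine ⟨fun k => |C| * ((1 + ‖k‖) ^ (d + 1))⁻¹, (summable_inv_one_add_norm_pow d).mul_left _,
    fun k => by positivity, fun k i z hz => ?_⟩
  dsimp only
  rw [← div_eq_mul_inv, le_div_iff₀ (by positivity), mul_right_comm, ← pow_add]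
  exact (hC k i z hz).trans (le_abs_self C)

theorem hasSum_mode {f : smoothFamilies d I} (hf : f ∈ uniformFamilies d I) (i : I)
    {z : Phase d} (hz : ‖z.1‖ ≤ 1) : HasSum (fun k => (mode k f).1 i z) (f.1 i z) := by
  obtain ⟨u, hu, -, hle⟩ := exists_summable_mode hf 0
  let F : C(UnitAddTorus (Fin d), ℂ) :=
    ⟨fun θ => f.1 i (z + (0, torusSection θ)), continuous_family_torusSection f i z⟩
  have hcoeff : mFourierCoeff F = fun k => (mode k f).1 i z := rfl
  have hsum : Summable (mFourierCoeff F) := by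
    rw [hcoeff]
    exact Summable.of_norm_bounded hu fun k => by simpa using hle k i z hz
  have hF : F 0 = f.1 i z := family_eq_of_toUnitTorus_eq f i (by simp) <| by
    simp [toUnitTorus_add, toUnitTorus_torusSection]
  have hone (k : Fin d → ℤ) : mFourier k 0 = 1 := by simp [mFourier]
  simpa only [hcoeff, hF, hone, smul_eq_mul, mul_one] using
    hasSum_mFourier_series_apply_of_summable hsum 0

end FourierSeries

section FourierMultipliers

/-- The Fourier multiplier with symbol `c i` truncated to the finite set of frequencies `F i`. -/
def fourierMultiplier (F : I → Finset (Fin d → ℤ)) (c : I → (Fin d → ℤ) → ℂ)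
    (f : smoothFamilies d I) : smoothFamilies d I :=
  ⟨fun i z => ∑ k ∈ F i, c i k * (mode k f).1 i z, fun i =>
    ⟨ContDiff.sum fun k _ => contDiff_const.mul (contDiff_family (mode k f) i),
      fun n z => Finset.sum_congr rfl fun k _ => by rw [periodic_family]⟩⟩

theorem fourierMultiplier_apply (F : I → Finset (Fin d → ℤ)) (c : I → (Fin d → ℤ) → ℂ)
    (f : smoothFamilies d I) (i : I) (z : Phase d) :
    (fourierMultiplier F c f).1 i z = ∑ k ∈ F i, c i k * (mode k f).1 i z :=
  rfl

theorem pderiv_fourierMultiplier (a : Fin d ⊕ Fin d) (F : I → Finset (Fin d → ℤ))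
    (c : I → (Fin d → ℤ) → ℂ) (f : smoothFamilies d I) :
    pderiv a (fourierMultiplier F c f) = fourierMultiplier F c (pderiv a f) := by
  ext i z
  have hdiff (k : Fin d → ℤ) := differentiable_family (mode k f) i z
  rw [fourierMultiplier_apply, pderiv_apply]
  change fderiv ℝ (fun z => ∑ k ∈ F i, c i k * (mode k f).1 i z) z _ = _
  rw [fderiv_fun_sum fun k _ => (hdiff k).const_mul (c i k), sum_apply]
  refine Finset.sum_congr rfl fun k _ => ?_
  rw [fderiv_const_mul (hdiff k), ← pderiv_mode]
  rfl

theorem iterPderiv_fourierMultiplier (l : List (Fin d ⊕ Fin d)) (F : I → Finset (Fin d → ℤ))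
    (c : I → (Fin d → ℤ) → ℂ) (f : smoothFamilies d I) :
    iterPderiv l (fourierMultiplier F c f) = fourierMultiplier F c (iterPderiv l f) := by
  induction l generalizing f with
  | nil => rfl
  | cons a l ih => rw [iterPderiv_cons, iterPderiv_cons, pderiv_fourierMultiplier, ih]

theorem fourierMultiplier_mem_uniformFamilies {F : I → Finset (Fin d → ℤ)}
    {c : I → (Fin d → ℤ) → ℂ} (hc : ∀ i, ∀ k ∈ F i, ‖c i k‖ ≤ 1) {f : smoothFamilies d I}
    (hf : f ∈ uniformFamilies d I) : fourierMultiplier F c f ∈ uniformFamilies d I := by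
  intro l
  rw [iterPderiv_fourierMultiplier]
  obtain ⟨u, hu, hu0, hle⟩ := exists_summable_mode (iterPderiv_mem_uniformFamilies hf l) 0
  refine ⟨∑' k, u k, fun i z hz => (norm_sum_le _ _).trans ?_⟩
  refine le_trans (Finset.sum_le_sum fun k hk => ?_) (hu.sum_le_tsum (F i) fun k _ => hu0 k)
  rw [norm_mul]
  exact (mul_le_of_le_one_left (norm_nonneg _) (hc i k hk)).trans (by simpa using hle k i z hz)

end FourierMultipliers

section HomologicalEquation

theorem poisson_linearHam_apply (v : I → Momentum d) (f : smoothFamilies d I) (i : I)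
    (z : Phase d) : (poisson (linearHam v) f).1 i z =
      -∑ j, (v i j : ℂ) * (pderiv (Sum.inr j) f).1 i z := by
  simp [poisson_linearHam]

theorem iterPderiv_poisson_linearHam (l : List (Fin d ⊕ Fin d)) (v : I → Momentum d)
    (f : smoothFamilies d I) :
    iterPderiv l (poisson (linearHam v) f) = poisson (linearHam v) (iterPderiv l f) := by
  induction l generalizing f with
  | nil => rfl
  | cons a l ih =>
    rw [iterPderiv_cons, iterPderiv_cons, ← ih]
    simp only [poisson_linearHam, map_neg, map_sum, pderiv_constFamily_mul, pderiv_comm a]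

theorem poisson_linearHam_mode_apply (v : I → Momentum d) (k : Fin d → ℤ)
    (f : smoothFamilies d I) (i : I) (z : Phase d) :
    (poisson (linearHam v) (mode k f)).1 i z =
      -(Complex.I * dot k (v i)) * (mode k f).1 i z := by
  have hterm (j : Fin d) : (v i j : ℂ) * (pderiv (Sum.inr j) (mode k f)).1 i z =
      Complex.I * (k j * v i j) * (mode k f).1 i z := by
    rw [pderiv_inr_mode]
    change (v i j : ℂ) * (Complex.I * k j * (mode k f).1 i z) = _
    ring
  simp only [poisson_linearHam_apply, hterm, ← Finset.sum_mul, ← Finset.mul_sum, dot, neg_mul]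
  push_cast
  rfl

theorem poisson_linearHam_fourierMultiplier (v : I → Momentum d) (F : I → Finset (Fin d → ℤ))
    (c : I → (Fin d → ℤ) → ℂ) (f : smoothFamilies d I) :
    poisson (linearHam v) (fourierMultiplier F c f) =
      fourierMultiplier F (fun i k => -(Complex.I * dot k (v i)) * c i k) f := by
  ext i z
  simp only [poisson_linearHam_apply, fourierMultiplier_apply, pderiv_fourierMultiplier,
    Finset.mul_sum]
  rw [Finset.sum_comm, ← Finset.sum_neg_distrib]
  refine Finset.sum_congr rfl fun k _ => ?_
  rw [mul_right_comm, ← poisson_linearHam_mode_apply, poisson_linearHam_apply, neg_mul,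
    Finset.sum_mul]
  simp only [pderiv_mode]
  exact congrArg _ <| Finset.sum_congr rfl fun j _ => by ring

theorem hasSum_poisson_linearHam {f : smoothFamilies d I} (hf : f ∈ uniformFamilies d I)
    (v : I → Momentum d) (i : I) {z : Phase d} (hz : ‖z.1‖ ≤ 1) :
    HasSum (fun k => -(Complex.I * dot k (v i)) * (mode k f).1 i z)
      ((poisson (linearHam v) f).1 i z) := by
  simp only [← poisson_linearHam_mode_apply, poisson_linearHam_apply, pderiv_mode]
  refine (hasSum_sum fun j _ => ?_).neg
  exact (hasSum_mode (pderiv_mem_uniformFamilies hf _) i hz).mul_left _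

theorem abs_dot_le (k : Fin d → ℤ) (v : Momentum d) : |dot k v| ≤ d * ‖v‖ * ‖k‖ := by
  calc |dot k v| ≤ ∑ j, |(k j : ℝ) * v j| := Finset.abs_sum_le_sum_abs _ _
    _ ≤ ∑ _j : Fin d, ‖v‖ * ‖k‖ := Finset.sum_le_sum fun j _ => by
        rw [abs_mul, mul_comm, ← Int.norm_eq_abs, ← Real.norm_eq_abs]
        exact mul_le_mul (PiLp.norm_apply_le v j) (norm_le_pi_norm k j) (norm_nonneg _)
          (norm_nonneg _)
    _ = d * ‖v‖ * ‖k‖ := by simp [mul_assoc]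

theorem finite_setOf_norm_le (K : ℝ) : {k : Fin d → ℤ | ‖k‖ ≤ K}.Finite := by
  simpa [Metric.closedBall, dist_eq_norm] using
    (isCompact_closedBall (0 : Fin d → ℤ) K).finite_of_discrete

open Classical in
/-- The frequencies eliminated by the homological equation: those with a divisor `k · v` of size at
least one, cut off at a size beyond which `|k · v|` is at most `‖k‖ ^ 2`. -/
def nonresonantFrequencies (X : ℝ) (v : Momentum d) : Finset (Fin d → ℤ) :=
  (finite_setOf_norm_le (max X (d * ‖v‖))).toFinset.filter fun k => 1 ≤ |dot k v|

theorem mem_nonresonantFrequencies {X : ℝ} {v : Momentum d} {k : Fin d → ℤ} :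
    k ∈ nonresonantFrequencies X v ↔ ‖k‖ ≤ max X (d * ‖v‖) ∧ 1 ≤ |dot k v| := by
  simp [nonresonantFrequencies]

/-- The small divisors `k · v` of all frequencies up to size `X` either vanish or have size at least
`δ`. -/
def HasDivisorGap (X δ : ℝ) (v : Momentum d) : Prop :=
  ∀ k : Fin d → ℤ, ‖k‖ ≤ X → dot k v = 0 ∨ δ ≤ |dot k v|

theorem pow_mul_abs_dot_le {X : ℝ} {v : Momentum d} {k : Fin d → ℤ} (hX : 0 ≤ X)
    (gap : HasDivisorGap X 1 v) (hk : k ∉ nonresonantFrequencies X v) (n : ℕ) :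
    X ^ n * |dot k v| ≤ (1 + ‖k‖) ^ (n + 2) := by
  rw [mem_nonresonantFrequencies, le_max_iff] at hk
  by_cases h0 : dot k v = 0
  · rw [h0, abs_zero, mul_zero]
    positivity
  have hkX : X ≤ ‖k‖ := by
    by_contra! hlt
    exact hk ⟨Or.inl hlt.le, (gap k hlt.le).resolve_left h0⟩
  have hdot : |dot k v| ≤ (1 + ‖k‖) ^ 2 := by
    rcases lt_or_ge |dot k v| 1 with hlt | hge
    · exact hlt.le.trans (one_le_pow₀ (by linarith [norm_nonneg k]))
    · have hv : d * ‖v‖ ≤ ‖k‖ := (not_le.1 fun hle => hk ⟨Or.inr hle, hge⟩).le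
      calc |dot k v| ≤ d * ‖v‖ * ‖k‖ := abs_dot_le k v
        _ ≤ ‖k‖ * ‖k‖ := by gcongr
        _ ≤ (1 + ‖k‖) ^ 2 := by nlinarith [norm_nonneg k]
  rw [pow_add]
  gcongr
  linarith

theorem uniformlyBounded_homological_remainder {X : I → ℝ} {v : I → Momentum d}
    (hX : ∀ i, 0 ≤ X i) (gap : ∀ i, HasDivisorGap (X i) 1 (v i))
    {f : smoothFamilies d I} (hf : f ∈ uniformFamilies d I) (n : ℕ) :
    UniformlyBounded (constFamily X ^ n * poisson (linearHam v)
      (f - fourierMultiplier (fun i => nonresonantFrequencies (X i) (v i)) 1 f)) := by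
  obtain ⟨u, hu, hu0, hle⟩ := exists_summable_mode hf (n + 2)
  refine ⟨∑' k, u k, fun i z hz => ?_⟩
  have hsplit : (poisson (linearHam v) (f - fourierMultiplier (fun i => nonresonantFrequencies (X i)
        (v i)) 1 f)).1 i z + ∑ k ∈ nonresonantFrequencies (X i) (v i),
        -(Complex.I * dot k (v i)) * (mode k f).1 i z = (poisson (linearHam v) f).1 i z := by
    rw [map_sub, poisson_linearHam_fourierMultiplier]
    simp [fourierMultiplier_apply]
  have hsum := (Finset.hasSum_compl_iff (nonresonantFrequencies (X i) (v i))).2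
    (hsplit ▸ hasSum_poisson_linearHam hf v i hz)
  have hterm (k : {k // k ∉ nonresonantFrequencies (X i) (v i)}) :
      ‖(X i : ℂ) ^ n * (-(Complex.I * dot k.1 (v i)) * (mode k.1 f).1 i z)‖ ≤ u k := by
    refine le_trans ?_ (hle k i z hz)
    rw [← mul_assoc, norm_mul]
    gcongr
    simpa [abs_of_nonneg (hX i)] using pow_mul_abs_dot_le (hX i) (gap i) k.2 n
  rw [← map_pow]
  change ‖(constFamily (X ^ n) : smoothFamilies d I).1 i z * _‖ ≤ _
  rw [constFamily_apply, Pi.pow_apply, Complex.ofReal_pow, ← (hsum.mul_left _).tsum_eq]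
  exact (tsum_of_norm_bounded (hu.subtype _).hasSum hterm).trans 
    (Summable.tsum_subtype_le u {k | k ∉ nonresonantFrequencies (X i) (v i)} hu0 hu)

theorem exists_homological_solution {X : I → ℝ} {v : I → Momentum d} (hX : ∀ i, 0 ≤ X i)
    (gap : ∀ i, HasDivisorGap (X i) 1 (v i)) {f : smoothFamilies d I}
    (hf : f ∈ uniformFamilies d I) :
    ∃ χ ∈ uniformFamilies d I, ∃ z ∈ uniformFamilies d I, f = poisson (linearHam v) χ + z ∧
      poisson (linearHam v) z ∈ negligibleFamilies d X := by
  set F := fun i => nonresonantFrequencies (X i) (v i)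
  refine ⟨fourierMultiplier F (fun i k => (-(Complex.I * dot k (v i)))⁻¹) f,
    fourierMultiplier_mem_uniformFamilies (fun i k hk => ?_) hf, f - fourierMultiplier F 1 f,
    sub_mem hf (fourierMultiplier_mem_uniformFamilies (by simp) hf), ?_, fun n l => ?_⟩
  · rw [norm_inv, norm_neg, norm_mul, Complex.norm_I, one_mul, Complex.norm_real]
    exact inv_le_one_of_one_le₀ (mem_nonresonantFrequencies.1 hk).2
  · rw [poisson_linearHam_fourierMultiplier, eq_comm, add_comm,
      sub_add_eq_add_sub, sub_eq_iff_eq_add, add_right_inj]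
    ext i z
    refine Finset.sum_congr rfl fun k hk => ?_
    have hdot : dot k (v i) ≠ 0 := fun h0 => by
      have := (mem_nonresonantFrequencies.1 hk).2
      rw [h0, abs_zero] at this
      linarith
    have hne : -(Complex.I * dot k (v i)) ≠ 0 := by simp [hdot]
    exact congrArg (· * (mode k f).1 i z) (mul_inv_cancel₀ hne)
  · rw [← map_pow, iterPderiv_constFamily_mul, map_pow, iterPderiv_poisson_linearHam, map_sub,
      iterPderiv_fourierMultiplier]
    exact uniformlyBounded_homological_remainder hX gap (iterPderiv_mem_uniformFamilies hf l) n

end HomologicalEquation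

section ApproximateIntegrals

theorem poisson_sum_pow_mul (J : ℕ → smoothFamilies d I) (f : smoothFamilies d I) (c : I → ℝ)
    (M : ℕ) :
    poisson (∑ n ∈ Finset.range (M + 1), constFamily c ^ n * J n) (J 0 + constFamily c * f) =
      ∑ n ∈ Finset.range M, constFamily c ^ (n + 1) * (poisson (J (n + 1)) (J 0) + poisson (J n) f)
        + constFamily c ^ (M + 1) * poisson (J M) f := by
  induction M with
  | zero => simp [poisson_self, poisson_constFamily_mul_right]
  | succ M ih =>
    rw [Finset.sum_range_succ, LinearMap.map_add₂, ih, Finset.sum_range_succ, ← map_pow,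
      poisson_constFamily_mul_left, map_add, poisson_constFamily_mul_right, map_pow]
    ring

variable {X : I → ℝ}

theorem constFamily_inv_pow_mul_mem (hX : ∀ i, 1 ≤ X i) (n : ℕ) {f : smoothFamilies d I}
    (hf : f ∈ uniformFamilies d I) : constFamily X⁻¹ ^ n * f ∈ uniformFamilies d I := by
  refine mul_mem (pow_mem (constFamily_mem_uniformFamilies (C := 1) fun i => ?_) n) hf
  rw [Pi.inv_apply, abs_inv]
  exact inv_le_one_of_one_le₀ ((hX i).trans (le_abs_self _))

theorem constFamily_pow_mul_poisson_sum_mem (hX : ∀ i, 1 ≤ X i) {J : ℕ → smoothFamilies d I}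
    {f : smoothFamilies d I} (hf : f ∈ uniformFamilies d I)
    (hJ : ∀ n, J (n + 1) ∈ uniformFamilies d I) {N : ℕ}
    (hneg : ∀ n < N + 1, poisson (J (n + 1)) (J 0) + poisson (J n) f ∈ negligibleFamilies d X) :
    constFamily X ^ N * poisson (∑ n ∈ Finset.range (N + 2), constFamily X⁻¹ ^ n * J n)
      (J 0 + constFamily X⁻¹ * f) ∈ uniformFamilies d I := by
  have hinv : constFamily X * constFamily X⁻¹ = (1 : smoothFamilies d I) := by
    rw [← map_mul, ← map_one constFamily]
    exact congrArg constFamily (funext fun i => mul_inv_cancel₀ (zero_lt_one.trans_le (hX i)).ne')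
  rw [poisson_sum_pow_mul, mul_add, Finset.mul_sum]
  refine add_mem (sum_mem fun n hn => ?_) ?_
  · rw [mul_left_comm]
    exact constFamily_inv_pow_mul_mem hX _ (hneg n (Finset.mem_range.1 hn) N)
  · rw [show N + 1 + 1 = N + 2 from rfl, pow_add, mul_assoc, ← mul_assoc, ← mul_pow, hinv, one_pow,
      one_mul]
    exact constFamily_inv_pow_mul_mem hX _ (poisson_mem_uniformFamilies (hJ N) hf)

theorem exists_approx_integral_family {η : I → ℝ} {v : I → Momentum d} (hX : ∀ i, 1 ≤ X i)
    (hη : ∀ i, |η i| ≤ 1) (gap : ∀ i, HasDivisorGap (X i) 1 (v i))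
    {g : smoothFamilies d I} (hg : g ∈ uniformFamilies d I) (N : ℕ) :
    ∃ A ∈ uniformFamilies d I, ∃ B ∈ uniformFamilies d I,
      constFamily X ^ N * poisson
        (linearHam v + constFamily X⁻¹ * (constFamily η * A) + constFamily X⁻¹ ^ 2 * B)
        (linearHam v + constFamily X⁻¹ * (kinetic + constFamily η * g)) ∈ uniformFamilies d I := by
  have hmul : ∀ {f}, f ∈ uniformFamilies d I → constFamily η * f ∈ uniformFamilies d I :=
    mul_mem (constFamily_mem_uniformFamilies hη)
  have hX0 (i : I) : 0 ≤ X i := zero_le_one.trans (hX i)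
  obtain ⟨χ, hχ, y, hy, hgy, hym⟩ := exists_homological_solution hX0 gap hg
  have hf : kinetic + constFamily η * g ∈ uniformFamilies d I :=
    add_mem kinetic_mem_uniformFamilies (hmul hg)
  have hz : kinetic + constFamily η * y ∈ uniformFamilies d I :=
    add_mem kinetic_mem_uniformFamilies (hmul hy)
  have hsol : kinetic + constFamily η * g =
      poisson (linearHam v) (constFamily η * χ) + (kinetic + constFamily η * y) := by
    rw [poisson_constFamily_mul_right]
    nth_rewrite 1 [hgy]
    ring
  have hzm : poisson (linearHam v) (kinetic + constFamily η * y) ∈ negligibleFamilies d X := by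
    rw [map_add, poisson_linearHam_kinetic, zero_add, poisson_constFamily_mul_right]
    intro n
    rw [mul_left_comm]
    exact hmul (hym n)
  obtain ⟨J, hJ0, hJ1, hJ, hneg⟩ := exists_formal_integral
    (U := Subalgebra.toSubmodule (uniformFamilies d I)) (m := negligibleFamilies d X)
    (fun f hf g hg => poisson_mem_uniformFamilies hf hg)
    (fun f hf => exists_homological_solution hX0 gap hf) poisson_jacobi
    (fun f hf g hg => poisson_mem_negligibleFamilies hf hg) (poisson_self _) hf (hmul hχ) hz hsol
    hzm N
  refine ⟨poisson (linearHam v) χ, ?_,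
    ∑ n ∈ Finset.range N, constFamily X⁻¹ ^ n * J (n + 2), ?_, ?_⟩
  · rw [show poisson (linearHam v) χ = g - y by rw [hgy]; abel]
    exact sub_mem hg hy
  · exact sum_mem fun n _ => constFamily_inv_pow_mul_mem hX n (hJ (n + 1))
  · have hsum := constFamily_pow_mul_poisson_sum_mem hX hf hJ fun n hn => by
      rw [hJ0]
      exact hneg n (Nat.lt_succ_iff.1 hn)
    have htail : constFamily X⁻¹ ^ 2 * ∑ n ∈ Finset.range N, constFamily X⁻¹ ^ n * J (n + 2) =
        ∑ n ∈ Finset.range N, constFamily X⁻¹ ^ (n + 1 + 1) * J (n + 1 + 1) := by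
      rw [Finset.mul_sum]
      exact Finset.sum_congr rfl fun n _ => by ring
    rw [Finset.sum_range_succ', Finset.sum_range_succ', hJ0, zero_add, hJ1,
      poisson_constFamily_mul_right, pow_zero, one_mul, pow_one] at hsum
    rw [htail]
    convert hsum using 3
    ring_nf

end ApproximateIntegrals

section Resonances

/-- The vector of `ℝ^d` with the given integer coordinates. -/
def intVec : (Fin d → ℤ) →+ Momentum d where
  toFun k := WithLp.toLp 2 fun j => (k j : ℝ)
  map_zero' := by ext; simp
  map_add' k l := by ext; simp

theorem inner_intVec (k : Fin d → ℤ) (w : Momentum d) : inner ℝ (intVec k) w = dot k w := by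
  rw [PiLp.inner_apply, dot]
  exact Finset.sum_congr rfl fun j _ => mul_comm _ _

theorem dot_intVec (k l : Fin d → ℤ) : dot k (intVec l) = (k ⬝ᵥ l : ℤ) := by
  simp [dot, dotProduct, intVec]

theorem norm_sq_intVec (k : Fin d → ℤ) : ‖intVec k‖ ^ 2 = (k ⬝ᵥ k : ℤ) := by
  rw [← real_inner_self_eq_norm_sq, inner_intVec, dot_intVec]

theorem one_le_dotProduct_self {k : Fin d → ℤ} (hk : k ≠ 0) : 1 ≤ k ⬝ᵥ k :=
  (Finset.sum_nonneg fun _ _ => mul_self_nonneg _).lt_of_ne' (mt dotProduct_self_eq_zero.1 hk)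

theorem one_le_norm_intVec {k : Fin d → ℤ} (hk : k ≠ 0) : 1 ≤ ‖intVec k‖ := by
  rw [← one_le_sq_iff₀ (norm_nonneg _), norm_sq_intVec]
  exact_mod_cast one_le_dotProduct_self hk

theorem norm_sq_intVec_le (k : Fin d → ℤ) : ‖intVec k‖ ^ 2 ≤ d * ‖k‖ ^ 2 := by
  rw [EuclideanSpace.norm_sq_eq]
  calc ∑ j, ‖intVec k j‖ ^ 2 ≤ ∑ _j : Fin d, ‖k‖ ^ 2 := by
        gcongr with j
        exact norm_le_pi_norm k j
    _ = d * ‖k‖ ^ 2 := by simp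

/-- The Gram determinant of a finite set of pairwise orthogonal integer vectors. -/
def gramDet (S : Finset (Fin d → ℤ)) : ℤ := ∏ k ∈ S, k ⬝ᵥ k

/-- The projection of `k` to the orthogonal complement of `S`, multiplied by the Gram determinant of
`S` so that it remains an integer vector. -/
def orthogonalize (S : Finset (Fin d → ℤ)) (k : Fin d → ℤ) : Fin d → ℤ :=
  gramDet S • k - ∑ x ∈ S, (gramDet (S.erase x) * (k ⬝ᵥ x)) • x

variable {S : Finset (Fin d → ℤ)}

theorem one_le_gramDet (hS : ∀ x ∈ S, x ≠ 0) : 1 ≤ gramDet S :=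
  Int.add_one_le_iff.2 <| Finset.prod_pos fun x hx =>
    zero_lt_one.trans_le (one_le_dotProduct_self (hS x hx))

theorem orthogonalize_dotProduct (hS : (S : Set (Fin d → ℤ)).Pairwise fun x y => x ⬝ᵥ y = 0)
    (k : Fin d → ℤ) {x : Fin d → ℤ} (hx : x ∈ S) : orthogonalize S k ⬝ᵥ x = 0 := by
  rw [orthogonalize, sub_dotProduct, sum_dotProduct, Finset.sum_eq_single_of_mem x hx, gramDet,
    ← Finset.mul_prod_erase S _ hx, smul_dotProduct, smul_dotProduct, gramDet, smul_eq_mul,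
    smul_eq_mul]
  · ring
  · intro y hy hyx
    rw [smul_dotProduct, hS hy hx hyx, smul_zero]

theorem dot_orthogonalize {w : Momentum d} (hw : ∀ x ∈ S, dot x w = 0) (k : Fin d → ℤ) :
    dot (orthogonalize S k) w = gramDet S * dot k w := by
  simp only [← inner_intVec] at hw ⊢
  simp only [orthogonalize, map_sub, map_sum, map_zsmul, inner_sub_left, sum_inner,
    ← Int.cast_smul_eq_zsmul ℝ, real_inner_smul_left]
  rw [Finset.sum_eq_zero fun x hx => by rw [hw x hx, mul_zero], sub_zero]

theorem orthogonalize_dotProduct_self_le (h0 : ∀ x ∈ S, x ≠ 0)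
    (hS : (S : Set (Fin d → ℤ)).Pairwise fun x y => x ⬝ᵥ y = 0) (k : Fin d → ℤ) :
    orthogonalize S k ⬝ᵥ orthogonalize S k ≤ gramDet S ^ 2 * (k ⬝ᵥ k) := by
  have hself : orthogonalize S k ⬝ᵥ orthogonalize S k =
      gramDet S * (orthogonalize S k ⬝ᵥ k) := by
    nth_rewrite 2 [orthogonalize]
    rw [dotProduct_sub, dotProduct_sum, Finset.sum_eq_zero, sub_zero, dotProduct_smul, smul_eq_mul]
    intro x hx
    rw [dotProduct_smul, orthogonalize_dotProduct hS k hx, smul_zero]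
  have hle : orthogonalize S k ⬝ᵥ k ≤ gramDet S * (k ⬝ᵥ k) := by
    rw [orthogonalize, sub_dotProduct, smul_dotProduct, smul_eq_mul, sub_le_self_iff,
      sum_dotProduct]
    refine Finset.sum_nonneg fun x _ => ?_
    rw [smul_dotProduct, smul_eq_mul, dotProduct_comm k x, mul_assoc]
    have : 1 ≤ gramDet (S.erase x) := one_le_gramDet fun y hy => h0 y (Finset.mem_of_mem_erase hy)
    exact mul_nonneg (by linarith) (mul_self_nonneg _)
  rw [hself, sq, mul_assoc]
  exact mul_le_mul_of_nonneg_left hle (by linarith [one_le_gramDet h0])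

theorem card_le_of_dotProduct_eq_zero (h0 : ∀ x ∈ S, x ≠ 0)
    (hS : (S : Set (Fin d → ℤ)).Pairwise fun x y => x ⬝ᵥ y = 0) : S.card ≤ d := by
  have hne (x : S) : intVec x.1 ≠ 0 := fun h => by
    have hx := one_le_norm_intVec (h0 x x.2)
    rw [h, norm_zero] at hx
    linarith
  have horth : Pairwise fun x y : S => inner ℝ (intVec x.1) (intVec y.1) = 0 := fun x y hxy => by
    dsimp only
    rw [inner_intVec, dot_intVec, hS x.2 y.2 (Subtype.coe_injective.ne hxy), Int.cast_zero]
  simpa using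
    (linearIndependent_of_ne_zero_of_inner_eq_zero (𝕜 := ℝ) hne horth).fintype_card_le_finrank

/-- `w` is orthogonal to each of the pairwise orthogonal nonzero integer vectors in `S`. -/
structure IsResonant (S : Finset (Fin d → ℤ)) (w : Momentum d) : Prop where
  ne_zero : ∀ x ∈ S, x ≠ 0
  pairwise : (S : Set (Fin d → ℤ)).Pairwise fun x y => x ⬝ᵥ y = 0
  dot_eq_zero : ∀ x ∈ S, dot x w = 0

/-- The orthogonal projection of `w` to the hyperplane of momenta resonant with `k`. -/
def resonantProjection (k : Fin d → ℤ) (w : Momentum d) : Momentum d :=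
  w - (dot k w / ‖intVec k‖ ^ 2) • intVec k

theorem dot_resonantProjection (x k : Fin d → ℤ) (w : Momentum d) :
    dot x (resonantProjection k w) = dot x w - dot k w / ‖intVec k‖ ^ 2 * (x ⬝ᵥ k : ℤ) := by
  rw [resonantProjection, ← inner_intVec, inner_sub_right, real_inner_smul_right, inner_intVec,
    inner_intVec, dot_intVec]

theorem norm_resonantProjection_sub_le {k : Fin d → ℤ} (hk : k ≠ 0) (w : Momentum d) :
    ‖resonantProjection k w - w‖ ≤ |dot k w| := by
  have hnorm := one_le_norm_intVec hk
  rw [resonantProjection, sub_sub_cancel_left, norm_neg, norm_smul, norm_div, norm_pow, norm_norm,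
    Real.norm_eq_abs, sq, ← div_div, div_mul_cancel₀ _ (by positivity)]
  exact div_le_self (abs_nonneg _) hnorm

theorem IsResonant.exists_insert {w : Momentum d} (hw : IsResonant S w) {k : Fin d → ℤ}
    (hk : dot k w ≠ 0) :
    ∃ (T : Finset (Fin d → ℤ)) (u : Momentum d), IsResonant T u ∧ T.card = S.card + 1 ∧
      gramDet T ≤ gramDet S ^ 3 * ‖intVec k‖ ^ 2 ∧ ‖u - w‖ ≤ gramDet S * |dot k w| := by
  obtain ⟨h0, hS, hdot⟩ := hw
  have hdet := one_le_gramDet h0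
  have hdet0 : (0 : ℝ) < gramDet S := by exact_mod_cast hdet
  set e := orthogonalize S k
  have he : dot e w = gramDet S * dot k w := dot_orthogonalize hdot k
  have hew : dot e w ≠ 0 := he ▸ mul_ne_zero hdet0.ne' hk
  have he0 : e ≠ 0 := fun h => hew (by rw [h, ← inner_intVec, map_zero, inner_zero_left])
  have heS : e ∉ S := fun h => hew (hdot e h)
  have hex {x} (hx : x ∈ S) : e ⬝ᵥ x = 0 := orthogonalize_dotProduct hS k hx
  have hxe {x} (hx : x ∈ S) : x ⬝ᵥ e = 0 := by rw [dotProduct_comm, hex hx]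
  classical
  refine ⟨insert e S, resonantProjection e w, ⟨?_, ?_, ?_⟩, Finset.card_insert_of_notMem heS, ?_,
    ?_⟩
  · simpa [he0] using h0
  · rw [Finset.coe_insert]
    exact hS.insert fun x hx _ => ⟨hex hx, hxe hx⟩
  · refine (Finset.forall_mem_insert _ _ _).2 ⟨?_, fun x hx => ?_⟩
    · have := one_le_norm_intVec he0
      rw [dot_resonantProjection, ← norm_sq_intVec, div_mul_cancel₀ _ (by positivity), sub_self]
    · rw [dot_resonantProjection, hdot x hx, hxe hx, Int.cast_zero, mul_zero, sub_zero]
  · have hle : gramDet (insert e S) ≤ gramDet S ^ 2 * (k ⬝ᵥ k) * gramDet S := by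
      rw [gramDet, Finset.prod_insert heS]
      exact mul_le_mul_of_nonneg_right (orthogonalize_dotProduct_self_le h0 hS k)
        (zero_le_one.trans hdet)
    rw [norm_sq_intVec]
    exact_mod_cast hle.trans_eq (by ring)
  · refine (norm_resonantProjection_sub_le he0 w).trans_eq ?_
    rw [he, abs_mul, abs_of_pos hdet0]

theorem exists_hasDivisorGap_or_isResonant (d j : ℕ) : ∃ A B : ℕ, ∀ X : ℝ, 16 ≤ X → d ≤ X →
    ∀ ρ₀ : ℝ, 0 < ρ₀ → ∀ p₀ : Momentum d,
    (∃ ρ w, ρ₀ ≤ ρ ∧ ρ ≤ X ^ B * ρ₀ ∧ ‖w - p₀‖ ≤ ρ / 8 ∧ HasDivisorGap X (X * ρ) w) ∨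
    ∃ (S : Finset (Fin d → ℤ)) (w : Momentum d), IsResonant S w ∧ S.card = j ∧
      gramDet S ≤ X ^ A ∧ ‖w - p₀‖ ≤ X ^ B * ρ₀ / 8 := by
  induction j with
  | zero =>
    refine ⟨0, 0, fun X _ _ ρ₀ hρ₀ p₀ => Or.inr ⟨∅, p₀, ⟨by simp, by simp, by simp⟩, by simp,
      by simp [gramDet], ?_⟩⟩
    rw [sub_self, norm_zero]
    positivity
  | succ j ih =>
    obtain ⟨A, B, h⟩ := ih
    refine ⟨3 * A + 3, A + 2 + B, fun X hX hdX ρ₀ hρ₀ p₀ => ?_⟩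
    have hX1 : 1 ≤ X := by linarith
    have hmono : X ^ B * ρ₀ ≤ X ^ (A + 2 + B) * ρ₀ :=
      mul_le_mul_of_nonneg_right (pow_le_pow_right₀ hX1 (by omega)) hρ₀.le
    rcases h X hX hdX ρ₀ hρ₀ p₀ with ⟨ρ, w, h1, h2, h3, h4⟩ | ⟨S, w, hw, hcard, hdet, hwp⟩
    · exact Or.inl ⟨ρ, w, h1, h2.trans hmono, h3, h4⟩
    by_cases hgap : HasDivisorGap X (X * (X ^ B * ρ₀)) w
    · exact Or.inl ⟨X ^ B * ρ₀, w, le_mul_of_one_le_left hρ₀.le (one_le_pow₀ hX1), hmono, hwp, hgap⟩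
    simp only [HasDivisorGap, not_forall, not_or, not_le] at hgap
    obtain ⟨k, hkX, hk0, hklt⟩ := hgap
    obtain ⟨T, u, hu, hT, hdet', hdist⟩ := hw.exists_insert hk0
    have hdet0 : (0 : ℝ) ≤ gramDet S := by exact_mod_cast (by linarith [one_le_gramDet hw.ne_zero])
    refine Or.inr ⟨T, u, hu, by rw [hT, hcard], ?_, ?_⟩
    · calc (gramDet T : ℝ) ≤ gramDet S ^ 3 * ‖intVec k‖ ^ 2 := hdet'
        _ ≤ (X ^ A) ^ 3 * (X * X ^ 2) := by
          gcongr
          exact (norm_sq_intVec_le k).trans (by gcongr)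
        _ = X ^ (3 * A + 3) := by ring
    · have hstep : ‖u - w‖ ≤ X ^ A * (X * (X ^ B * ρ₀)) := hdist.trans (by gcongr)
      calc ‖u - p₀‖ ≤ ‖u - w‖ + ‖w - p₀‖ := norm_sub_le_norm_sub_add_norm_sub u w p₀
        _ ≤ X ^ A * (X * (X ^ B * ρ₀)) + X ^ A * X * (X ^ B * ρ₀) / 8 := by
          gcongr
          refine hwp.trans (div_le_div_of_nonneg_right ?_ (by norm_num))
          exact le_mul_of_one_le_left (by positivity) (one_le_mul_of_one_le_of_one_le
            (one_le_pow₀ hX1) hX1)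
        _ = 9 * (X ^ A * X * (X ^ B * ρ₀)) / 8 := by ring
        _ ≤ X * (X ^ A * X * (X ^ B * ρ₀)) / 8 := by
          gcongr
          linarith
        _ = X ^ (A + 2 + B) * ρ₀ / 8 := by ring

theorem exists_hasDivisorGap (d : ℕ) : ∃ B : ℕ, ∀ X : ℝ, 16 ≤ X → d ≤ X →
    ∀ ρ₀ : ℝ, 0 < ρ₀ → ∀ p₀ : Momentum d, ∃ ρ w, ρ₀ ≤ ρ ∧ ρ ≤ X ^ B * ρ₀ ∧ ‖w - p₀‖ ≤ ρ / 8 ∧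
      HasDivisorGap X (X * ρ) w := by
  obtain ⟨A, B, h⟩ := exists_hasDivisorGap_or_isResonant d (d + 1)
  refine ⟨B, fun X hX hdX ρ₀ hρ₀ p₀ => (h X hX hdX ρ₀ hρ₀ p₀).resolve_right ?_⟩
  rintro ⟨S, w, hw, hcard, -⟩
  have := card_le_of_dotProduct_eq_zero hw.ne_zero hw.pairwise
  omega

end Resonances

section GlobalExistence

open Set Manifold

variable {E : Type*} [NormedAddCommGroup E] [NormedSpace ℝ E] [CompleteSpace E] {v : E → E}
  {K : NNReal}

theorem exists_solution_Ioo_of_lipschitzWith (hv : LipschitzWith K v) (x : E) :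
    ∃ γ : ℝ → E, γ 0 = x ∧
      ∀ t ∈ Ioo (-(1 + K : ℝ)⁻¹) (1 + K : ℝ)⁻¹, HasDerivAt γ (v (γ t)) t := by
  have hτ : 0 < (1 + K : ℝ)⁻¹ := by positivity
  -- On the ball of radius `a` around `x` the speed is at most `(1 + K) a`.
  set a : NNReal := ‖v x‖₊ + 1 with ha
  have hpl : IsPicardLindelof (fun _ => v) (tmin := -(1 + K : ℝ)⁻¹) (tmax := (1 + K : ℝ)⁻¹)
      ⟨0, by constructor <;> linarith⟩ x a 0 ((1 + K) * a) K := by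
    refine IsPicardLindelof.of_time_independent (fun y hy => ?_) hv.lipschitzOnWith ?_
    · have hyx : ‖v y - v x‖ ≤ K * a := (hv.norm_sub_le y x).trans
        (mul_le_mul_of_nonneg_left (mem_closedBall_iff_norm.1 hy) K.2)
      have hvx : ‖v x‖ ≤ a := by simp [ha]
      refine (norm_le_norm_sub_add (v y) (v x)).trans ((add_le_add hyx hvx).trans_eq ?_)
      push_cast
      ring
    · have hK : (1 + K : ℝ) ≠ 0 := by positivity
      simp [mul_assoc, mul_left_comm _ (a : ℝ), mul_inv_cancel₀ hK]
  obtain ⟨γ, h0, hγ⟩ := hpl.exists_eq_forall_mem_Icc_hasDerivWithinAt₀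
  exact ⟨γ, h0, fun t ht => (hγ t (Ioo_subset_Icc_self ht)).hasDerivAt
    (Icc_mem_nhds ht.1 ht.2)⟩

theorem exists_global_solution_of_lipschitzWith (hv : ContDiff ℝ 1 v) (hK : LipschitzWith K v)
    (x₀ : E) : ∃ γ : ℝ → E, γ 0 = x₀ ∧ ∀ t, HasDerivAt γ (v (γ t)) t := by
  have hv' : ContMDiff 𝓘(ℝ, E) 𝓘(ℝ, E).tangent 1
      (fun x => (⟨x, v x⟩ : TangentBundle 𝓘(ℝ, E) E)) := fun x =>
    contMDiffAt_vectorSpace_iff_contDiffAt.2 hv.contDiffAt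
  obtain ⟨γ, h0, hγ⟩ := exists_isMIntegralCurve_of_isMIntegralCurveOn (I := 𝓘(ℝ, E)) hv'
    (ε := (1 + K : ℝ)⁻¹) (by positivity) (fun x => by
      obtain ⟨γ, h0, hγ⟩ := exists_solution_Ioo_of_lipschitzWith hK x
      exact ⟨γ, h0, fun t ht => (hγ t ht).hasFDerivAt.hasMFDerivAt.hasMFDerivWithinAt⟩) x₀
  exact ⟨γ, h0, fun t => (hγ t).hasFDerivAt⟩

end GlobalExistence

section HamiltonianVectorField

/-- The symplectic gradient `(-∂H/∂q, ∂H/∂p)`, as a function of the differential of `H`. -/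
def sympGrad : (Phase d →L[ℝ] ℝ) →L[ℝ] Phase d :=
  LinearMap.toContinuousLinearMap
    { toFun := fun L => (WithLp.toLp 2 fun j => -L (coordDir (Sum.inr j)),
        WithLp.toLp 2 fun j => L (coordDir (Sum.inl j)))
      map_add' := fun L M => by ext j <;> simp [add_comm]
      map_smul' := fun c L => by ext j <;> simp }

theorem sympGrad_fst_apply (L : Phase d →L[ℝ] ℝ) (j : Fin d) :
    (sympGrad L).1 j = -L (coordDir (Sum.inr j)) := rfl

theorem sympGrad_snd_apply (L : Phase d →L[ℝ] ℝ) (j : Fin d) :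
    (sympGrad L).2 j = L (coordDir (Sum.inl j)) := rfl

theorem eq_sum_coordDir (u : Phase d) :
    u = ∑ j, (u.1 j • coordDir (Sum.inl j) + u.2 j • coordDir (Sum.inr j)) := by
  ext k
  · simp [coordDir, Prod.fst_sum, Pi.single_apply]
  · simp [coordDir, Prod.snd_sum, Pi.single_apply]

theorem apply_sympGrad_self (L : Phase d →L[ℝ] ℝ) : L (sympGrad L) = 0 := by
  rw [eq_sum_coordDir (sympGrad L), map_sum]
  refine Finset.sum_eq_zero fun j _ => ?_
  rw [map_add, map_smul, map_smul, sympGrad_fst_apply, sympGrad_snd_apply, smul_eq_mul,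
    smul_eq_mul]
  ring

theorem eq_of_hasDerivAt_smul_sympGrad {H : Phase d → ℝ} (hH : Differentiable ℝ H) {c : ℝ}
    {γ : ℝ → Phase d} (hγ : ∀ t, HasDerivAt γ (c • sympGrad (fderiv ℝ H (γ t))) t) (t s : ℝ) :
    H (γ t) = H (γ s) := by
  have hderiv (t : ℝ) : HasDerivAt (H ∘ γ) 0 t := by
    refine ((hH (γ t)).hasFDerivAt.comp_hasDerivAt t (hγ t)).congr_deriv ?_
    rw [map_smul, apply_sympGrad_self, smul_zero]
  exact is_const_of_deriv_eq_zero (fun t => (hderiv t).differentiableAt)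
    (fun t => (hderiv t).deriv) t s

theorem hasDerivAt_phase_iff {γ : ℝ → Phase d} {u : Phase d} {t : ℝ} : HasDerivAt γ u t ↔
    ∀ j, HasDerivAt (fun s => (γ s).1 j) (u.1 j) t ∧ HasDerivAt (fun s => (γ s).2 j) (u.2 j) t := by
  constructor
  · exact fun h j =>
      ⟨(EuclideanSpace.proj (𝕜 := ℝ) j ∘L ContinuousLinearMap.fst ℝ (Momentum d)
        (EuclideanSpace ℝ (Fin d))).hasFDerivAt.comp_hasDerivAt t h,
      (EuclideanSpace.proj (𝕜 := ℝ) j ∘L ContinuousLinearMap.snd ℝ (Momentum d)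
        (EuclideanSpace ℝ (Fin d))).hasFDerivAt.comp_hasDerivAt t h⟩
  · intro h
    let L : (Fin d → ℝ) →L[ℝ] EuclideanSpace ℝ (Fin d) := (EuclideanSpace.equiv (Fin d) ℝ).symm
    have hfst := L.hasFDerivAt.comp_hasDerivAt t (hasDerivAt_pi.2 fun j => (h j).1)
    have hsnd := L.hasFDerivAt.comp_hasDerivAt t (hasDerivAt_pi.2 fun j => (h j).2)
    exact hfst.prodMk hsnd

theorem isSolution_iff {H : Momentum d → Torus d → ℝ} {p : ℝ → Momentum d} {q : ℝ → Torus d} :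
    IsSolution H p q ↔ ∃ x : ℝ → EuclideanSpace ℝ (Fin d), (∀ t, toTorus (x t) = q t) ∧
      ∀ t, HasDerivAt (fun s => ((p s, x s) : Phase d))
        (sympGrad (fderiv ℝ (lift H) (p t, x t))) t := by
  simp only [hasDerivAt_phase_iff]
  rfl

theorem toTorus_surjective :
    Function.Surjective (toTorus : EuclideanSpace ℝ (Fin d) → Torus d) := fun q => by
  choose x hx using fun j => QuotientAddGroup.mk_surjective (q j)
  exact ⟨WithLp.toLp 2 x, funext hx⟩

theorem exists_isSolution {H : Momentum d → Torus d → ℝ} (hH : ContDiff ℝ 2 (lift H)) {K : NNReal}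
    (hK : LipschitzWith K (fderiv ℝ (lift H))) (p₀ : Momentum d) (q₀ : Torus d) :
    ∃ p q, IsSolution H p q ∧ p 0 = p₀ ∧ q 0 = q₀ := by
  obtain ⟨x₀, rfl⟩ := toTorus_surjective q₀
  obtain ⟨γ, h0, hγ⟩ := exists_global_solution_of_lipschitzWith
    (sympGrad.contDiff.comp (hH.fderiv_right le_rfl)) (sympGrad.lipschitz.comp hK) (p₀, x₀)
  exact ⟨fun t => (γ t).1, fun t => toTorus (γ t).2,
    isSolution_iff.2 ⟨fun t => (γ t).2, fun _ => rfl, hγ⟩,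
    congrArg Prod.fst h0, congrArg (fun z => toTorus z.2) h0⟩

variable {V : Momentum d → Torus d → ℝ}

theorem lift_hamiltonian (V : Momentum d → Torus d → ℝ) (ε : ℝ) :
    lift (hamiltonian V ε) = fun z => ‖z.1‖ ^ 2 / 2 + ε * lift V z := by
  ext z
  rw [EuclideanSpace.real_norm_sq_eq, Finset.sum_div]
  rfl

theorem contDiff_lift_hamiltonian (hV : IsSmooth V) (ε : ℝ) :
    ContDiff ℝ ∞ (lift (hamiltonian V ε)) := by
  rw [lift_hamiltonian]
  exact ((contDiff_fst.norm_sq ℝ).div_const 2).add (contDiff_const.mul hV)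

theorem fderiv_lift_hamiltonian (hV : IsSmooth V) (ε : ℝ) (z : Phase d) :
    fderiv ℝ (lift (hamiltonian V ε)) z =
      innerSL ℝ z.1 ∘L ContinuousLinearMap.fst ℝ _ _ + ε • fderiv ℝ (lift V) z := by
  have hkin : HasFDerivAt (fun z : Phase d => ‖z.1‖ ^ 2 / 2)
      (innerSL ℝ z.1 ∘L ContinuousLinearMap.fst ℝ _ _) z := by
    have h := ((hasFDerivAt_fst (𝕜 := ℝ) (p := z)).norm_sq).const_mul (2⁻¹ : ℝ)
    rw [← Nat.cast_smul_eq_nsmul ℝ, smul_smul, Nat.cast_ofNat, inv_mul_cancel₀ two_ne_zero,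
      one_smul] at h
    simpa only [div_eq_inv_mul] using h
  have hpot := (ContDiff.differentiable hV (by simp) z).hasFDerivAt.const_mul ε
  rw [lift_hamiltonian]
  exact (hkin.add hpot).fderiv

theorem exists_lipschitzWith_fderiv_lift (hV : IsSmooth V) (hVb : IsGloballyBounded V) :
    ∃ K, LipschitzWith K (fderiv ℝ (lift V)) := by
  have hd : Differentiable ℝ (fderiv ℝ (lift V)) :=
    (ContDiff.fderiv_right hV (m := ∞) (by simp)).differentiable (by simp)
  obtain ⟨K, hK⟩ := hVb 2
  refine ⟨K.toNNReal, lipschitzWith_of_nnnorm_fderiv_le hd fun z => ?_⟩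
  rw [← NNReal.coe_le_coe, coe_nnnorm, ← norm_iteratedFDeriv_one, norm_iteratedFDeriv_fderiv]
  exact (hK z).trans (Real.le_coe_toNNReal K)

theorem exists_isSolution_hamiltonian (hV : IsSmooth V) (hVb : IsGloballyBounded V) (ε : ℝ)
    (p₀ : Momentum d) (q₀ : Torus d) :
    ∃ p q, IsSolution (hamiltonian V ε) p q ∧ p 0 = p₀ ∧ q 0 = q₀ := by
  obtain ⟨K, hK⟩ := exists_lipschitzWith_fderiv_lift hV hVb
  let L : Phase d →L[ℝ] Phase d →L[ℝ] ℝ :=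
    (ContinuousLinearMap.compL ℝ (Phase d) (Momentum d) ℝ).flip (ContinuousLinearMap.fst ℝ _ _) ∘L
      (innerSL ℝ) ∘L ContinuousLinearMap.fst ℝ _ _
  refine exists_isSolution (contDiff_infty.1 (contDiff_lift_hamiltonian hV ε) 2)
    (K := ‖L‖₊ + ‖ε‖₊ * K) ?_ p₀ q₀
  rw [funext (fderiv_lift_hamiltonian hV ε)]
  exact L.lipschitz.add ((lipschitzWith_smul ε).comp hK)

end HamiltonianVectorField

section Rescaling

/-- The data of a localization near a momentum `w`: the small divisors of `w` up to the frequency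
cutoff `X` are either zero or at least `X ρ`, where `ρ` is the radius of the localization. In the
variable `P = (p - w) / ρ` the potential has relative size `η`. -/
structure Scaling (d : ℕ) where
  X : ℝ
  ρ : ℝ
  η : ℝ
  w : Momentum d
  one_le_X : 1 ≤ X
  ρ_pos : 0 < ρ
  ρ_le_one : ρ ≤ 1
  η_nonneg : 0 ≤ η
  η_mul_X_le_one : η * X ≤ 1
  gap : HasDivisorGap X (X * ρ) w

namespace Scaling

variable (i : Scaling d)

theorem X_pos : 0 < i.X := zero_lt_one.trans_le i.one_le_X

theorem η_le_inv : i.η ≤ i.X⁻¹ := by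
  rw [← one_div, le_div_iff₀ i.X_pos]
  exact i.η_mul_X_le_one

theorem abs_η_le_one : |i.η| ≤ 1 := by
  rw [abs_of_nonneg i.η_nonneg]
  exact i.η_le_inv.trans (inv_le_one_of_one_le₀ i.one_le_X)

/-- The affine change of variables `p = w + ρ P`. -/
def chart (z : Phase d) : Phase d := (i.w + i.ρ • z.1, z.2)

/-- The inverse of `chart`. -/
def chartInv (z : Phase d) : Phase d := (i.ρ⁻¹ • (z.1 - i.w), z.2)

theorem chart_chartInv (z : Phase d) : i.chart (i.chartInv z) = z := by
  simp only [chart, chartInv, smul_inv_smul₀ i.ρ_pos.ne', add_sub_cancel]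

/-- The derivative of `chart`. -/
def chartDeriv : Phase d →L[ℝ] Phase d :=
  (i.ρ • ContinuousLinearMap.fst ℝ (Momentum d) (EuclideanSpace ℝ (Fin d))).prod
    (ContinuousLinearMap.snd ℝ _ _)

theorem hasFDerivAt_chart (z : Phase d) : HasFDerivAt i.chart i.chartDeriv z :=
  ((hasFDerivAt_fst.const_smul i.ρ).const_add i.w).prodMk hasFDerivAt_snd

theorem contDiff_chart : ContDiff ℝ ∞ i.chart := by
  unfold chart
  fun_prop

theorem hasDerivAt_chartInv {γ : ℝ → Phase d} {u : Phase d} {t : ℝ} (h : HasDerivAt γ u t) :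
    HasDerivAt (fun s => i.chartInv (γ s)) (i.ρ⁻¹ • u.1, u.2) t :=
  have hfst := (ContinuousLinearMap.fst ℝ (Momentum d)
    (EuclideanSpace ℝ (Fin d))).hasFDerivAt.comp_hasDerivAt t h
  have hsnd := (ContinuousLinearMap.snd ℝ (Momentum d)
    (EuclideanSpace ℝ (Fin d))).hasFDerivAt.comp_hasDerivAt t h
  ((hfst.sub_const i.w).const_smul i.ρ⁻¹).prodMk hsnd

/-- The factor that the partial derivatives pick up under composition with `chart`. -/
def factor : Fin d ⊕ Fin d → ℝ
  | Sum.inl _ => i.ρ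
  | Sum.inr _ => 1

theorem chartDeriv_coordDir (a : Fin d ⊕ Fin d) :
    i.chartDeriv (coordDir a) = i.factor a • coordDir a := by
  cases a <;> simp [chartDeriv, coordDir, factor]

theorem abs_factor_le_one (a : Fin d ⊕ Fin d) : |i.factor a| ≤ 1 := by
  cases a
  · exact (abs_of_pos i.ρ_pos).trans_le i.ρ_le_one
  · exact abs_one.le

theorem sympGrad_comp_chartDeriv (L : Phase d →L[ℝ] ℝ) :
    sympGrad (L ∘L i.chartDeriv) = i.ρ • (i.ρ⁻¹ • (sympGrad L).1, (sympGrad L).2) := by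
  have hρ := i.ρ_pos.ne'
  ext j <;> simp [sympGrad_fst_apply, sympGrad_snd_apply, chartDeriv_coordDir, factor, hρ]

/-- The frequency vector `w` in the rescaled variables. -/
def freq : Momentum d := (i.X * i.ρ)⁻¹ • i.w

theorem hasDivisorGap_freq : HasDivisorGap i.X 1 i.freq := fun k hk => by
  have hXρ : 0 < i.X * i.ρ := mul_pos i.X_pos i.ρ_pos
  rw [freq, ← inner_intVec, real_inner_smul_right, inner_intVec, abs_mul,
    abs_of_pos (inv_pos.2 hXρ), inv_mul_eq_div, inv_mul_eq_div, one_le_div hXρ]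
  exact (i.gap k hk).imp_left fun h => by rw [h, zero_div]

/-- The Hamiltonian in the rescaled variables, up to the factor `X ρ ^ 2` and an additive
constant; see `lift_hamiltonian_chart`. -/
def ham (V : Momentum d → Torus d → ℝ) (z : Phase d) : ℝ :=
  inner ℝ i.freq z.1 + i.X⁻¹ * (‖z.1‖ ^ 2 / 2 + i.η * lift V (i.chart z))

theorem lift_hamiltonian_chart (V : Momentum d → Torus d → ℝ) (z : Phase d) :
    lift (hamiltonian V (i.η * i.ρ ^ 2)) (i.chart z) =
      ‖i.w‖ ^ 2 / 2 + i.X * i.ρ ^ 2 * i.ham V z := by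
  have hρ := i.ρ_pos.ne'
  have hX := i.X_pos.ne'
  have hnorm : ‖(i.chart z).1‖ ^ 2 =
      ‖i.w‖ ^ 2 + 2 * (i.ρ * inner ℝ i.w z.1) + i.ρ ^ 2 * ‖z.1‖ ^ 2 := by
    rw [chart, norm_add_sq_real, real_inner_smul_right, norm_smul, mul_pow, Real.norm_eq_abs,
      sq_abs]
  simp only [lift_hamiltonian]
  rw [hnorm, ham, freq, real_inner_smul_left]
  field_simp
  ring

theorem ham_eq (V : Momentum d → Torus d → ℝ) : i.ham V = fun z =>
    (i.X * i.ρ ^ 2)⁻¹ * (lift (hamiltonian V (i.η * i.ρ ^ 2)) (i.chart z) - ‖i.w‖ ^ 2 / 2) := by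
  have hne : i.X * i.ρ ^ 2 ≠ 0 := (mul_pos i.X_pos (pow_pos i.ρ_pos 2)).ne'
  ext z
  rw [lift_hamiltonian_chart, add_sub_cancel_left, inv_mul_cancel_left₀ hne]

variable {i} {V : Momentum d → Torus d → ℝ}

theorem hasFDerivAt_ham (hV : IsSmooth V) (z : Phase d) : HasFDerivAt (i.ham V)
    ((i.X * i.ρ ^ 2)⁻¹ •
      (fderiv ℝ (lift (hamiltonian V (i.η * i.ρ ^ 2))) (i.chart z) ∘L i.chartDeriv)) z := by
  have h := (contDiff_lift_hamiltonian hV (i.η * i.ρ ^ 2)).differentiable (by simp) (i.chart z)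
  rw [ham_eq]
  exact ((h.hasFDerivAt.comp z (i.hasFDerivAt_chart z)).sub_const _).const_mul _

theorem hasDerivAt_chartInv_of_hasDerivAt (hV : IsSmooth V) {c : ℝ} {γ : ℝ → Phase d} {t : ℝ}
    (hγ : HasDerivAt γ
      (c • sympGrad (fderiv ℝ (lift (hamiltonian V (i.η * i.ρ ^ 2))) (γ t))) t) :
    HasDerivAt (fun s => i.chartInv (γ s))
      ((c * (i.X * i.ρ)) • sympGrad (fderiv ℝ (i.ham V) (i.chartInv (γ t)))) t := by
  have hρ := i.ρ_pos.ne'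
  have hX := i.X_pos.ne'
  refine (i.hasDerivAt_chartInv hγ).congr_deriv ?_
  rw [(hasFDerivAt_ham hV _).fderiv, map_smul, sympGrad_comp_chartDeriv, chart_chartInv, smul_smul,
    smul_smul, show c * (i.X * i.ρ) * (i.X * i.ρ ^ 2)⁻¹ * i.ρ = c by field_simp]
  ext j <;> simp [mul_left_comm]

end Scaling

theorem toTorus_add_period (q : EuclideanSpace ℝ (Fin d)) (n : Fin d → ℤ) :
    toTorus (q + period n) = toTorus q := by
  ext j
  change ((q j + 2 * Real.pi * n j : ℝ) : AddCircle (2 * Real.pi)) = (q j : AddCircle _)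
  rw [AddCircle.coe_add, mul_comm _ (n j : ℝ), ← zsmul_eq_mul, AddCircle.coe_zsmul,
    AddCircle.coe_period, smul_zero, add_zero]

/-- A function on phase space, as a family indexed by a point. -/
def potential {V : Momentum d → Torus d → ℝ} (hV : IsSmooth V) : smoothFamilies d Unit :=
  ⟨fun _ z => (lift V z : ℂ), fun _ => ⟨Complex.ofRealCLM.contDiff.comp hV,
    fun n z => by simp [lift, toTorus_add_period]⟩⟩

theorem exists_norm_iteratedFDeriv_potential_le {V : Momentum d → Torus d → ℝ} (hV : IsSmooth V)
    (hVb : IsGloballyBounded V) (n : ℕ) :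
    ∃ K : ℝ, ∀ z, ‖iteratedFDeriv ℝ n ((potential hV).1 ()) z‖ ≤ K := by
  obtain ⟨K, hK⟩ := hVb n
  exact ⟨K, fun z => (Complex.ofRealLI.norm_iteratedFDeriv_comp_left (f := lift V) (x := z)
    (i := n) (ContDiff.contDiffAt hV) (mod_cast le_top)).trans_le (hK z)⟩

/-- The family of all rescalings of a function. -/
def rescale (g : smoothFamilies d Unit) : smoothFamilies d (Scaling d) :=
  ⟨fun i z => g.1 () (i.chart z), fun i => ⟨(contDiff_family g ()).comp i.contDiff_chart,
    fun n z => by simpa [Scaling.chart] using periodic_family g () n (i.chart z)⟩⟩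

theorem pderiv_rescale (a : Fin d ⊕ Fin d) (g : smoothFamilies d Unit) :
    pderiv a (rescale g) = constFamily (fun i => i.factor a) * rescale (pderiv a g) := by
  ext i z
  have h := ((differentiable_family g () (i.chart z)).hasFDerivAt.comp z
    (i.hasFDerivAt_chart z)).fderiv
  change fderiv ℝ (g.1 () ∘ i.chart) z (coordDir a) =
    (i.factor a : ℂ) * fderiv ℝ (g.1 ()) (i.chart z) (coordDir a)
  rw [h, ContinuousLinearMap.comp_apply, i.chartDeriv_coordDir, map_smul, Complex.real_smul]

theorem exists_norm_iteratedFDeriv_pderiv_le (a : Fin d ⊕ Fin d) {g : smoothFamilies d Unit}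
    (hg : ∀ n : ℕ, ∃ K : ℝ, ∀ z, ‖iteratedFDeriv ℝ n (g.1 ()) z‖ ≤ K) (n : ℕ) :
    ∃ K : ℝ, ∀ z, ‖iteratedFDeriv ℝ n ((pderiv a g).1 ()) z‖ ≤ K := by
  obtain ⟨K, hK⟩ := hg (n + 1)
  refine ⟨‖(coordDir a : Phase d)‖ * K, fun z => ?_⟩
  have h := norm_iteratedFDeriv_clm_apply_const (c := coordDir a) (n := n) (x := z)
    ((contDiff_family g ()).fderiv_right (m := ∞) (by simp)).contDiffAt (mod_cast le_top)
  rw [norm_iteratedFDeriv_fderiv] at h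
  exact h.trans (mul_le_mul_of_nonneg_left (hK z) (norm_nonneg _))

theorem rescale_mem_uniformFamilies {g : smoothFamilies d Unit}
    (hg : ∀ n : ℕ, ∃ K : ℝ, ∀ z, ‖iteratedFDeriv ℝ n (g.1 ()) z‖ ≤ K) :
    rescale g ∈ uniformFamilies d (Scaling d) := fun l => by
  induction l generalizing g with
  | nil =>
    obtain ⟨K, hK⟩ := hg 0
    exact ⟨K, fun i z _ => norm_iteratedFDeriv_zero.symm.trans_le (hK (i.chart z))⟩
  | cons a l ih =>
    rw [iterPderiv_cons, pderiv_rescale, iterPderiv_constFamily_mul]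
    exact UniformlyBounded.mul
      (uniformlyBounded_of_mem (constFamily_mem_uniformFamilies fun i => i.abs_factor_le_one a))
      (ih (exists_norm_iteratedFDeriv_pderiv_le a hg))

/-- The Hamiltonians `Scaling.ham` in all rescaled variables, as a family. -/
def hamFamily {V : Momentum d → Torus d → ℝ} (hV : IsSmooth V) : smoothFamilies d (Scaling d) :=
  linearHam Scaling.freq +
    constFamily Scaling.X⁻¹ * (kinetic + constFamily Scaling.η * rescale (potential hV))

theorem linearHam_apply (v : I → Momentum d) (i : I) (z : Phase d) :
    (linearHam v).1 i z = (inner ℝ (v i) z.1 : ℝ) := by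
  rw [linearHam, AddSubmonoidClass.coe_finsetSum, Finset.sum_apply, Finset.sum_apply,
    PiLp.inner_apply, Complex.ofReal_sum]
  refine Finset.sum_congr rfl fun j _ => ?_
  rw [RCLike.inner_apply, conj_trivial, mul_comm, Complex.ofReal_mul]
  rfl

theorem kinetic_apply (i : I) (z : Phase d) :
    (kinetic : smoothFamilies d I).1 i z = (‖z.1‖ ^ 2 / 2 : ℝ) := by
  change (2⁻¹ : ℂ) * (∑ j, momentumCoord j * momentumCoord j : smoothFamilies d I).1 i z = _
  rw [AddSubmonoidClass.coe_finsetSum, Finset.sum_apply, Finset.sum_apply,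
    EuclideanSpace.real_norm_sq_eq, div_eq_inv_mul, Complex.ofReal_mul, Complex.ofReal_sum,
    Complex.ofReal_inv, Complex.ofReal_ofNat]
  refine congrArg _ (Finset.sum_congr rfl fun j _ => ?_)
  rw [Complex.ofReal_pow, sq]
  rfl

theorem hamFamily_apply {V : Momentum d → Torus d → ℝ} (hV : IsSmooth V) (i : Scaling d)
    (z : Phase d) : (hamFamily hV).1 i z = (i.ham V z : ℝ) := by
  change (linearHam Scaling.freq).1 i z + ((i.X⁻¹ : ℝ) : ℂ) *
    ((kinetic : smoothFamilies d (Scaling d)).1 i z + (i.η : ℂ) * (lift V (i.chart z) : ℂ)) = _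
  rw [linearHam_apply, kinetic_apply, Scaling.ham]
  push_cast
  rfl

theorem poisson_apply_of_real (f : smoothFamilies d I) {h : smoothFamilies d I} {i : I}
    {k : Phase d → ℝ} (hk : ∀ z, h.1 i z = k z) {z : Phase d} (hdiff : DifferentiableAt ℝ k z) :
    (poisson f h).1 i z = fderiv ℝ (f.1 i) z (sympGrad (fderiv ℝ k z)) := by
  have hderiv (u : Phase d) : fderiv ℝ (h.1 i) z u = (fderiv ℝ k z u : ℝ) := by
    rw [show h.1 i = Complex.ofRealCLM ∘ k from funext hk,
      (Complex.ofRealCLM.hasFDerivAt.comp z hdiff.hasFDerivAt).fderiv]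
    rfl
  rw [eq_sum_coordDir (sympGrad (fderiv ℝ k z)), map_sum, poisson_def,
    AddSubmonoidClass.coe_finsetSum, Finset.sum_apply, Finset.sum_apply]
  refine Finset.sum_congr rfl fun j _ => ?_
  change fderiv ℝ (f.1 i) z (coordDir (Sum.inr j)) * fderiv ℝ (h.1 i) z (coordDir (Sum.inl j)) -
    fderiv ℝ (f.1 i) z (coordDir (Sum.inl j)) * fderiv ℝ (h.1 i) z (coordDir (Sum.inr j)) = _
  rw [hderiv, hderiv, map_add, map_smul, map_smul, sympGrad_fst_apply, sympGrad_snd_apply,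
    Complex.real_smul, Complex.real_smul]
  push_cast
  ring

theorem exists_norm_sub_linearHam_le {A B : smoothFamilies d (Scaling d)}
    (hA : UniformlyBounded A) (hB : UniformlyBounded B) :
    ∃ C : ℝ, ∀ (i : Scaling d) (z : Phase d), ‖z.1‖ ≤ 1 →
      ‖(linearHam Scaling.freq + constFamily Scaling.X⁻¹ * (constFamily Scaling.η * A) +
        constFamily Scaling.X⁻¹ ^ 2 * B).1 i z - ((inner ℝ i.freq z.1 : ℝ) : ℂ)‖ ≤ C / i.X ^ 2 := by
  obtain ⟨a, ha⟩ := hA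
  obtain ⟨b, hb⟩ := hB
  refine ⟨a + b, fun i z hz => ?_⟩
  have hX := i.X_pos
  change ‖(linearHam Scaling.freq).1 i z + ((i.X⁻¹ : ℝ) : ℂ) * ((i.η : ℂ) * A.1 i z) +
    ((i.X⁻¹ : ℝ) : ℂ) ^ 2 * B.1 i z - ((inner ℝ i.freq z.1 : ℝ) : ℂ)‖ ≤ _
  rw [linearHam_apply, add_assoc, add_sub_cancel_left]
  calc _ ≤ i.X⁻¹ * (i.η * ‖A.1 i z‖) + i.X⁻¹ ^ 2 * ‖B.1 i z‖ := by
        refine (norm_add_le _ _).trans_eq ?_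
        rw [norm_mul, norm_mul, norm_mul, norm_pow, Complex.norm_real, Complex.norm_real,
          Real.norm_of_nonneg (inv_pos.2 hX).le, Real.norm_of_nonneg i.η_nonneg]
    _ ≤ i.X⁻¹ * (i.X⁻¹ * a) + i.X⁻¹ ^ 2 * b := by
        gcongr
        exacts [i.η_le_inv, ha i z hz, hb i z hz]
    _ = (a + b) / i.X ^ 2 := by field_simp

theorem exists_approx_integral {V : Momentum d → Torus d → ℝ} (hV : IsSmooth V)
    (hVb : IsGloballyBounded V) (N : ℕ) :
    ∃ C : ℝ, ∀ i : Scaling d, ∃ G : Phase d → ℂ, Differentiable ℝ G ∧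
      (∀ z, ‖z.1‖ ≤ 1 → ‖G z - ((inner ℝ i.freq z.1 : ℝ) : ℂ)‖ ≤ C / i.X ^ 2) ∧
      ∀ z, ‖z.1‖ ≤ 1 → ‖fderiv ℝ G z (sympGrad (fderiv ℝ (i.ham V) z))‖ ≤ C / i.X ^ N := by
  obtain ⟨A, hA, B, hB, hR⟩ := exists_approx_integral_family Scaling.one_le_X
    Scaling.abs_η_le_one Scaling.hasDivisorGap_freq
    (rescale_mem_uniformFamilies (exists_norm_iteratedFDeriv_potential_le hV hVb)) N
  obtain ⟨C, hC⟩ := exists_norm_sub_linearHam_le (uniformlyBounded_of_mem hA)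
    (uniformlyBounded_of_mem hB)
  obtain ⟨R, hR⟩ := uniformlyBounded_of_mem hR
  refine ⟨max C R, fun i => ⟨_, differentiable_family _ i, fun z hz => (hC i z hz).trans ?_,
    fun z hz => ?_⟩⟩
  · have hX := i.X_pos
    gcongr
    exact le_max_left C R
  · have hX := i.X_pos
    rw [← poisson_apply_of_real _ (hamFamily_apply hV i)
      (Scaling.hasFDerivAt_ham hV z).differentiableAt, le_div_iff₀' (pow_pos hX N)]
    refine le_trans (le_of_eq ?_) ((hR i z hz).trans (le_max_right C R))
    change _ = ‖(i.X : ℂ) ^ N * _‖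
    rw [norm_mul, norm_pow, Complex.norm_real, Real.norm_of_nonneg hX.le]
    rfl

end Rescaling

section Confinement

theorem le_half_of_bootstrap {φ : ℝ → ℝ} (hφ : Continuous φ) {T : ℝ}
    (step : ∀ t ∈ Set.Icc 0 T, (∀ s ∈ Set.Icc 0 t, φ s ≤ 1) → φ t ≤ 1 / 2) (h0 : φ 0 ≤ 1 / 2) :
    ∀ t ∈ Set.Icc 0 T, φ t ≤ 1 / 2 := fun t ht => by
  have hivt {r : ℝ} (hr : 0 ≤ r) (h : 1 < φ r) : ∃ a ∈ Set.Icc 0 r, φ a = 1 :=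
    intermediate_value_Icc hr hφ.continuousOn ⟨by linarith, h.le⟩
  refine step t ht ?_
  by_contra! hcon
  obtain ⟨s, hs, hs1⟩ := hcon
  have hcompact : IsCompact (Set.Icc 0 s ∩ φ ⁻¹' {1}) :=
    isCompact_Icc.inter_right (isClosed_singleton.preimage hφ)
  -- Let `a` be the first time at which `φ` takes the value `1`.
  obtain ⟨a, ⟨ha, ha1 : φ a = 1⟩, hmin⟩ := hcompact.exists_isLeast (hivt hs.1 hs1)
  have hbefore (r : ℝ) (hr : r ∈ Set.Icc 0 a) : φ r ≤ 1 := by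
    by_contra! hr1
    obtain ⟨c, hc, hc1⟩ := hivt hr.1 hr1
    have hac : a ≤ c := hmin ⟨⟨hc.1, (hc.2.trans hr.2).trans ha.2⟩, hc1⟩
    rw [← hc1, le_antisymm hc.2 (hr.2.trans hac)] at hr1
    exact lt_irrefl _ hr1
  have := step a ⟨ha.1, (ha.2.trans hs.2).trans ht.2⟩ hbefore
  linarith

variable {V : Momentum d → Torus d → ℝ} {i : Scaling d}

theorem abs_inner_freq_sub_le {G : Phase d → ℂ} {C : ℝ} {N : ℕ} (hdiff : Differentiable ℝ G)
    (hG : ∀ z, ‖z.1‖ ≤ 1 → ‖G z - ((inner ℝ i.freq z.1 : ℝ) : ℂ)‖ ≤ C / i.X ^ 2)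
    (hdrift : ∀ z, ‖z.1‖ ≤ 1 →
      ‖fderiv ℝ G z (sympGrad (fderiv ℝ (i.ham V) z))‖ ≤ C / i.X ^ (N + 3))
    {c : ℝ} (hc : |c| ≤ i.X) {ζ : ℝ → Phase d}
    (hζ : ∀ t, HasDerivAt ζ (c • sympGrad (fderiv ℝ (i.ham V) (ζ t))) t) {t : ℝ}
    (ht : t ∈ Set.Icc 0 (i.X ^ N)) (hle : ∀ s ∈ Set.Icc 0 t, ‖(ζ s).1‖ ≤ 1) :
    |inner ℝ i.freq (ζ t).1 - inner ℝ i.freq (ζ 0).1| ≤ 3 * C / i.X ^ 2 := by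
  have hX := i.X_pos
  have hC : 0 ≤ C / i.X ^ (N + 3) := (norm_nonneg _).trans (hdrift 0 (by simp))
  have hGdrift : ‖G (ζ t) - G (ζ 0)‖ ≤ C / i.X ^ 2 :=
    calc ‖G (ζ t) - G (ζ 0)‖ ≤ i.X * (C / i.X ^ (N + 3)) * (t - 0) := by
          refine norm_image_sub_le_of_norm_deriv_le_segment'
            (fun r _ => ((hdiff _).hasFDerivAt.comp_hasDerivAt r (hζ r)).hasDerivWithinAt)
            (fun r hr => ?_) t ⟨ht.1, le_rfl⟩
          rw [map_smul, norm_smul]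
          exact mul_le_mul hc (hdrift _ (hle r ⟨hr.1, hr.2.le⟩)) (norm_nonneg _) hX.le
      _ ≤ i.X * (C / i.X ^ (N + 3)) * i.X ^ N := by
          rw [sub_zero]
          exact mul_le_mul_of_nonneg_left ht.2 (mul_nonneg hX.le hC)
      _ = C / i.X ^ 2 := by
          field_simp
          ring
  have hdecomp : ((inner ℝ i.freq (ζ t).1 - inner ℝ i.freq (ζ 0).1 : ℝ) : ℂ) =
      G (ζ t) - G (ζ 0) - (G (ζ t) - ((inner ℝ i.freq (ζ t).1 : ℝ) : ℂ)) +
        (G (ζ 0) - ((inner ℝ i.freq (ζ 0).1 : ℝ) : ℂ)) := by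
    push_cast
    ring
  rw [← Real.norm_eq_abs, ← Complex.norm_real, hdecomp]
  refine (norm_add_le_of_le (norm_sub_le_of_le hGdrift (hG _ (hle t ⟨ht.1, le_rfl⟩)))
    (hG _ (hle 0 ⟨le_rfl, ht.1⟩))).trans_eq (by ring)

/-- Since the energy is `freq · P` plus a small multiple of a convex function of `P`, its
conservation turns control of `freq · P` into control of `P`. -/
theorem norm_fst_le_half {C K : ℝ} (hK : ∀ z, |lift V z| ≤ K) (hX : 16 * (C + 2 * K) ≤ i.X)
    {y z : Phase d} (hham : i.ham V y = i.ham V z)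
    (hfreq : |inner ℝ i.freq y.1 - inner ℝ i.freq z.1| ≤ C / i.X ^ 2) (hz : ‖z.1‖ ≤ 1 / 8) :
    ‖y.1‖ ≤ 1 / 2 := by
  have hX0 := i.X_pos
  have henergy : ‖y.1‖ ^ 2 / 2 = ‖z.1‖ ^ 2 / 2 -
      i.X * (inner ℝ i.freq y.1 - inner ℝ i.freq z.1) -
      i.η * (lift V (i.chart y) - lift V (i.chart z)) := by
    simp only [Scaling.ham] at hham
    field_simp at hham
    linarith
  have hlinear : -(i.X * (inner ℝ i.freq y.1 - inner ℝ i.freq z.1)) ≤ C / i.X :=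
    calc _ ≤ i.X * |inner ℝ i.freq y.1 - inner ℝ i.freq z.1| := by
          rw [← mul_neg]
          exact mul_le_mul_of_nonneg_left (neg_le_abs _) hX0.le
      _ ≤ i.X * (C / i.X ^ 2) := mul_le_mul_of_nonneg_left hfreq hX0.le
      _ = C / i.X := by field_simp
  have hpotential : -(i.η * (lift V (i.chart y) - lift V (i.chart z))) ≤ 2 * K / i.X :=
    calc _ ≤ i.η * |lift V (i.chart y) - lift V (i.chart z)| := by
          rw [← mul_neg]
          exact mul_le_mul_of_nonneg_left (neg_le_abs _) i.η_nonneg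
      _ ≤ i.X⁻¹ * (K + K) := mul_le_mul i.η_le_inv
          ((abs_sub _ _).trans (add_le_add (hK _) (hK _))) (abs_nonneg _) (inv_pos.2 hX0).le
      _ = 2 * K / i.X := by ring
  have hsmall : C / i.X + 2 * K / i.X ≤ 1 / 16 := by
    rw [← add_div, div_le_iff₀ hX0]
    linarith
  have hz2 : ‖z.1‖ ^ 2 ≤ (1 / 8) ^ 2 := pow_le_pow_left₀ (norm_nonneg _) hz 2
  exact le_of_sq_le_sq (by linarith) (by norm_num)

theorem exists_confinement (hV : IsSmooth V) (hVb : IsGloballyBounded V) (N : ℕ) :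
    ∃ X₀ : ℝ, ∀ i : Scaling d, X₀ ≤ i.X → ∀ (c : ℝ) (ζ : ℝ → Phase d), |c| ≤ i.X →
      (∀ t, HasDerivAt ζ (c • sympGrad (fderiv ℝ (i.ham V) (ζ t))) t) → ‖(ζ 0).1‖ ≤ 1 / 8 →
      ∀ t ∈ Set.Icc 0 (i.X ^ N), ‖(ζ t).1‖ ≤ 1 / 2 := by
  obtain ⟨C, hC⟩ := exists_approx_integral hV hVb (N + 3)
  obtain ⟨K, hK⟩ := hVb 0
  refine ⟨16 * (3 * C + 2 * K), fun i hX c ζ hc hζ h0 => ?_⟩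
  obtain ⟨G, hdiff, hG, hdrift⟩ := hC i
  have hcont : Continuous fun t => ‖(ζ t).1‖ :=
    (continuous_iff_continuousAt.2 fun t => (hζ t).continuousAt).fst.norm
  have hham (t : ℝ) : i.ham V (ζ t) = i.ham V (ζ 0) :=
    eq_of_hasDerivAt_smul_sympGrad
      (fun z => (Scaling.hasFDerivAt_ham hV z).differentiableAt) hζ t 0
  exact le_half_of_bootstrap hcont (fun t ht hle => norm_fst_le_half (fun z => by simpa using hK z)
    hX (hham t) (abs_inner_freq_sub_le hdiff hG hdrift hc hζ ht hle) h0) (h0.trans (by norm_num))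

theorem exists_confinement_smul (hV : IsSmooth V) (hVb : IsGloballyBounded V) (N : ℕ) :
    ∃ X₀ : ℝ, ∀ i : Scaling d, X₀ ≤ i.X → ∀ (c : ℝ) (γ : ℝ → Phase d), |c| ≤ 1 →
      (∀ t, HasDerivAt γ
        (c • sympGrad (fderiv ℝ (lift (hamiltonian V (i.η * i.ρ ^ 2))) (γ t))) t) →
      ‖(γ 0).1 - i.w‖ ≤ i.ρ / 8 → ∀ t ∈ Set.Icc 0 (i.X ^ N), ‖(γ t).1 - i.w‖ ≤ i.ρ / 2 := by
  obtain ⟨X₀, h⟩ := exists_confinement hV hVb N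
  refine ⟨X₀, fun i hX c γ hc hγ h0 t ht => ?_⟩
  have hnorm (z : Phase d) (a : ℝ) : ‖(i.chartInv z).1‖ ≤ 1 / a ↔ ‖z.1 - i.w‖ ≤ i.ρ / a := by
    rw [Scaling.chartInv, norm_smul, norm_inv, Real.norm_of_nonneg i.ρ_pos.le,
      inv_mul_le_iff₀ i.ρ_pos, mul_one_div]
  have hspeed : |c * (i.X * i.ρ)| ≤ i.X := by
    rw [abs_mul, abs_of_pos (mul_pos i.X_pos i.ρ_pos)]
    have := mul_le_mul_of_nonneg_left i.ρ_le_one i.X_pos.le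
    nlinarith [abs_nonneg c, mul_pos i.X_pos i.ρ_pos]
  exact (hnorm _ _).1 (h i hX _ _ hspeed
    (fun t => Scaling.hasDerivAt_chartInv_of_hasDerivAt hV (hγ t)) ((hnorm _ _).2 h0) t ht)

theorem exists_solution_confinement (hV : IsSmooth V) (hVb : IsGloballyBounded V) (N : ℕ) :
    ∃ X₀ : ℝ, ∀ i : Scaling d, X₀ ≤ i.X → ∀ (p : ℝ → Momentum d) (q : ℝ → Torus d),
      IsSolution (hamiltonian V (i.η * i.ρ ^ 2)) p q → ‖p 0 - i.w‖ ≤ i.ρ / 8 →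
      ∀ t, |t| ≤ i.X ^ N → ‖p t - p 0‖ ≤ i.ρ := by
  obtain ⟨X₀, h⟩ := exists_confinement_smul hV hVb N
  refine ⟨X₀, fun i hX p q hsol h0 t ht => ?_⟩
  obtain ⟨x, -, hγ⟩ := isSolution_iff.1 hsol
  have hρ := i.ρ_pos
  suffices hclose : ‖p t - i.w‖ ≤ i.ρ / 2 by
    calc ‖p t - p 0‖ = ‖(p t - i.w) - (p 0 - i.w)‖ := by rw [sub_sub_sub_cancel_right]
      _ ≤ ‖p t - i.w‖ + ‖p 0 - i.w‖ := norm_sub_le _ _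
      _ ≤ i.ρ := by linarith
  -- The curve `s ↦ (p, x) (σ s)`, where `σ = 1` or `σ = -1`, reaches time `t` at `|t|`.
  obtain ⟨σ, hσ, hσt⟩ : ∃ σ : ℝ, |σ| ≤ 1 ∧ σ * |t| = t := by
    rcases abs_choice t with ht | ht
    · exact ⟨1, abs_one.le, by rw [one_mul, ht]⟩
    · exact ⟨-1, by simp, by rw [ht, neg_mul_neg, one_mul]⟩
  have hγσ (s : ℝ) := (hγ (σ * s)).scomp s (hasDerivAt_const_mul σ)
  have := h i hX σ _ hσ hγσ (by simpa using h0) |t| ⟨abs_nonneg t, ht⟩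
  simpa [hσt] using this

end Confinement

section Stability

variable {V : Momentum d → Torus d → ℝ}

theorem exists_scaling {ε X ρ : ℝ} (hε : 0 ≤ ε) (hX : 1 ≤ X) (hρ : 0 < ρ) (hρ1 : ρ ≤ 1)
    (hεX : ε * X ≤ ρ ^ 2) {w : Momentum d} (hgap : HasDivisorGap X (X * ρ) w) :
    ∃ i : Scaling d, i.X = X ∧ i.ρ = ρ ∧ i.w = w ∧ i.η * i.ρ ^ 2 = ε :=
  ⟨{ X := X
     ρ := ρ
     η := ε / ρ ^ 2
     w := w
     one_le_X := hX
     ρ_pos := hρ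
     ρ_le_one := hρ1
     η_nonneg := by positivity
     η_mul_X_le_one := by rwa [div_mul_eq_mul_div, div_le_one (by positivity)]
     gap := hgap }, rfl, rfl, rfl, div_mul_cancel₀ _ (by positivity)⟩

theorem exists_scaling_near (d : ℕ) {b : ℝ} (hb0 : 0 < b) (hb : b < 1 / 2) :
    ∃ δ : ℝ, 0 < δ ∧ ∀ ε : ℝ, 0 < ε → ε ≤ 1 → 16 ≤ ε ^ (-δ) → d ≤ ε ^ (-δ) →
      ∀ p₀ : Momentum d, ∃ i : Scaling d, i.X = ε ^ (-δ) ∧ i.η * i.ρ ^ 2 = ε ∧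
        ‖p₀ - i.w‖ ≤ i.ρ / 8 ∧ i.ρ ≤ ε ^ b := by
  obtain ⟨B, hB⟩ := exists_hasDivisorGap d
  obtain ⟨δ, hδ, hδB⟩ : ∃ δ : ℝ, 0 < δ ∧ δ * (B + 1) = 1 / 2 - b :=
    ⟨(1 / 2 - b) / (B + 1), div_pos (by linarith) (by positivity), by field_simp⟩
  refine ⟨δ, hδ, fun ε hε hε1 h16 hd p₀ => ?_⟩
  set X : ℝ := ε ^ (-δ) with hX
  obtain ⟨ρ, w, hρ₀, hρX, hw, hgap⟩ := hB X h16 hd (X * √ε) (by positivity) p₀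
  have hρ : 0 < ρ := lt_of_lt_of_le (by positivity) hρ₀
  have hρb : ρ ≤ ε ^ b := by
    refine hρX.trans_eq ?_
    rw [← mul_assoc, ← pow_succ, hX, ← Real.rpow_mul_natCast hε.le, Real.sqrt_eq_rpow,
      ← Real.rpow_add hε]
    congr 1
    push_cast
    linarith
  have hεX : ε * X ≤ ρ ^ 2 :=
    calc ε * X ≤ X * (ε * X) := le_mul_of_one_le_left (by positivity) (by linarith)
      _ = (X * √ε) ^ 2 := by rw [mul_pow, Real.sq_sqrt hε.le]; ring
      _ ≤ ρ ^ 2 := pow_le_pow_left₀ (by positivity) hρ₀ 2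
  obtain ⟨i, hiX, rfl, rfl, hi⟩ := exists_scaling hε.le (by linarith) hρ
    (hρb.trans (Real.rpow_le_one hε.le hε1 hb0.le)) hεX hgap
  exact ⟨i, hiX, hi, by rwa [norm_sub_rev], hρb⟩

theorem exists_stability (hV : IsSmooth V) (hVb : IsGloballyBounded V) {b : ℝ} (hb0 : 0 < b)
    (hb : b < 1 / 2) (M : ℝ) : ∃ ε₀ : ℝ, 0 < ε₀ ∧ ∀ ε : ℝ, 0 < ε → ε < ε₀ →
      ∀ (p : ℝ → Momentum d) (q : ℝ → Torus d), IsSolution (hamiltonian V ε) p q →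
      ∀ t : ℝ, |t| ≤ 1 / ε ^ M → ‖p t - p 0‖ ≤ ε ^ b := by
  obtain ⟨δ, hδ, hscale⟩ := exists_scaling_near d hb0 hb
  obtain ⟨X₀, hconf⟩ := exists_solution_confinement hV hVb ⌈M / δ⌉₊
  obtain ⟨ε₁, hε₁ : 0 < ε₁, hlarge⟩ := mem_nhdsGT_iff_exists_Ioo_subset.1
    ((tendsto_rpow_neg_nhdsGT_zero (neg_lt_zero.2 hδ)).eventually_ge_atTop
      (max 16 (max (d : ℝ) X₀)))
  refine ⟨min ε₁ 1, lt_min hε₁ one_pos, fun ε hε hlt p q hsol t ht => ?_⟩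
  obtain ⟨hlt₁, hlt1⟩ := lt_min_iff.1 hlt
  obtain ⟨h16, hd, hX₀⟩ : 16 ≤ ε ^ (-δ) ∧ (d : ℝ) ≤ ε ^ (-δ) ∧ X₀ ≤ ε ^ (-δ) := by
    simpa only [max_le_iff, Set.mem_ofPred_eq] using hlarge ⟨hε, hlt₁⟩
  obtain ⟨i, hiX, rfl, hw, hρ⟩ := hscale ε hε hlt1.le h16 hd (p 0)
  refine (hconf i (hiX ▸ hX₀) p q hsol hw t (ht.trans ?_)).trans hρ
  calc 1 / (i.η * i.ρ ^ 2) ^ M = i.X ^ (M / δ) := by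
        rw [hiX, ← Real.rpow_mul hε.le, one_div, ← Real.rpow_neg hε.le]
        congr 1
        field_simp
    _ ≤ i.X ^ (⌈M / δ⌉₊ : ℝ) := Real.rpow_le_rpow_of_exponent_le i.one_le_X (Nat.le_ceil _)
    _ = i.X ^ ⌈M / δ⌉₊ := Real.rpow_natCast _ _

end Stability

end SmoothNekhoroshev

end

theorem theorem1p1 (d : ℕ)
    (V : SmoothNekhoroshev.Momentum d → SmoothNekhoroshev.Torus d → ℝ)
    (hV : SmoothNekhoroshev.IsSmooth V) (hVb : SmoothNekhoroshev.IsGloballyBounded V)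
    (b : ℝ) (hb0 : 0 < b) (hb : b < 1 / 2) (M : ℝ) (hM : 0 < M) :
    ∃ C ε₀ : ℝ, 0 < C ∧ 0 < ε₀ ∧ ∀ ε : ℝ, 0 < ε → ε < ε₀ →
      ∀ (p₀ : SmoothNekhoroshev.Momentum d) (q₀ : SmoothNekhoroshev.Torus d),
        (∃ (p : ℝ → SmoothNekhoroshev.Momentum d) (q : ℝ → SmoothNekhoroshev.Torus d),
          SmoothNekhoroshev.IsSolution (SmoothNekhoroshev.hamiltonian V ε) p q ∧
            p 0 = p₀ ∧ q 0 = q₀) ∧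
        ∀ (p : ℝ → SmoothNekhoroshev.Momentum d) (q : ℝ → SmoothNekhoroshev.Torus d),
          SmoothNekhoroshev.IsSolution (SmoothNekhoroshev.hamiltonian V ε) p q →
          p 0 = p₀ → q 0 = q₀ →
          ∀ t : ℝ, |t| ≤ C / ε ^ M → ‖p t - p 0‖ ≤ C * ε ^ b := by
  obtain ⟨ε₀, hε₀, h⟩ := SmoothNekhoroshev.exists_stability hV hVb hb0 hb M
  refine ⟨1, ε₀, one_pos, hε₀, fun ε hε hlt p₀ q₀ =>
    ⟨SmoothNekhoroshev.exists_isSolution_hamiltonian hV hVb ε p₀ q₀,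
      fun p q hsol _ _ t ht => ?_⟩⟩
  rw [one_mul]
  exact h ε hε hlt p q hsol t ht
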